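/- Conventions. Functionals are linear and unital on $\mathbb{C}\langle x_1,\dots,x_d\rangle$ (non-commuting variables, $x_i^*=x_i$); a state is a functional that is moreover $*$-compatible and satisfies $\varphi[P^*P]\ge 0$. For a functional $\varphi$ let $M^\varphi(\mathbf z)=\sum_{|u|\ge1}\varphi[x_u]z_u$, $\eta^\varphi=1-(1+M^\varphi)^{-1}$ (Boolean cumulants), and let $R^\varphi$ be the series with $M^\varphi(\mathbf w)=R^\varphi((1+M^\varphi(\mathbf w))\mathbf w)$ (free cumulants). The convolutions and their real powers are the functionals determined by $R^{\varphi\boxplus\psi}=R^\varphi+R^\psi$, $R^{\varphi^{\boxplus t}}=tR^\varphi$, $\eta^{\varphi\uplus\psi}=\eta^\varphi+\eta^\psi$, $\eta^{\varphi^{\uplus t}}=t\eta^\varphi$; $\delta_{\mathbf a}[P]=P(a_1,\dots,a_d)$ for $\mathbf a\in\mathbb{R}^d$. Define $\Phi[\rho,\psi]$ by $\eta^{\Phi[\rho,\psi]}(\mathbf w)=(1+M^\psi(\mathbf w))^{-1}R^\rho((1+M^\psi(\mathbf w))\mathbf w)$, and, for $\mathbf a\in\mathbb{R}^d$ and real $t\ne-1$,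 $$B_{\mathbf a,t}[\rho]=\bigl((\rho^{\boxplus(1+t)}\boxplus\delta_{\mathbf a})\uplus\delta_{-\mathbf a}\bigr)^{\uplus 1/(1+t)}.$$ A probability measure on $\mathbb{R}$ with finite moments is identified, in these formulas, with its moment functional on $\mathbb{C}\langle x_1\rangle$. For $b\in\mathbb{R}$, $c\ge-1$, the free Meixner distribution $\mu_{b,c}$ is the probability measure on $\mathbb{R}$ with Jacobi parameter sequences $(0,b,b,\dots)$, $(1,1+c,1+c,\dots)$. With the left derivatives $D_i(z_iz_u)=z_u$, $D_i(z_jz_u)=0$ for $j\neq i$, $D_i1=0$, the free Meixner state $\varphi_{\{T_i\},C}$, where $T_i=(B_{ij}^k)_{j,k}$ are complex $d\times d$ matrices and $C=(C_{ij})$ is real, identified with the operator $e_i\otimes e_j\mapsto C_{ij}\,e_i\otimes e_j$, is the state with zero means such that, for all $i,j$, $$D_iD_jR^\varphi=\delta_{ij}+\sum_kB_{ij}^kD_kR^\varphi+C_{ij}\,D_iR^\varphi\,D_jR^\varphi .$$ Lemma. (0) For all $b\in\mathbb{R}$, $c\ge-1$ the measure $\mu_{b,c}$ exists and is unique. If all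 $T_i$ are Hermitian, all $C_{ij}\ge-1$, and each $T_i\otimes I$ commutes with $C$, then $\varphi_{\{T_i\},C}$ exists and is unique. (a) If $c\ge-1$, $c+t\ge-1$, $t\neq-1$ and $\alpha\in\mathbb{R}$, then $B_{\alpha,t}[\mu_{b,c}]=\mu_{b+\alpha,c+t}$; in particular it is again a free Meixner distribution. (b) If $\varphi_{\{T_i\},C}$ is a free Meixner state, $\mathbf a\in\mathbb{R}^d$, $t\ne-1$ and $t+C_{ij}\ge-1$ for all $i,j$, then $B_{\mathbf a,t}[\varphi_{\{T_i\},C}]=\varphi_{\{a_iI+T_i\},\,tI+C}$; in particular it is again a free Meixner state. (c) $\mu_{0,-1}=\tfrac12\delta_{-1}+\tfrac12\delta_1$, and for every free Meixner distribution $\mu_{b,c}$ there are $\alpha\in\mathbb{R}$ and $t\ge0$ with $B_{\alpha,t}\bigl[\tfrac12\delta_{-1}+\tfrac12\delta_1\bigr]=\mu_{b,c}$. (d) If $c\ge-1$, $c+t\ge-1$ and $\alpha\in\mathbb{R}$, then $\Phi\bigl[\mu_{b,c},\ \mu_{b,c}^{\boxplus(1+t)}\boxplus\delta_\alpha\bigr]=\mu_{b+\alpha,c+t}$,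 and this equals $B_{\alpha,t}[\mu_{b,c}]$ if $t\ne-1$. -/

import Mathlib

open MeasureTheory

/-! ### Non-commutative formal power series -/

/-- Formal power series with complex coefficients in `d` non-commuting variables: a series is
the family of its coefficients, indexed by words in the letters `0, …, d - 1`. -/
def NCSeries (d : ℕ) : Type := List (Fin d) → ℂ

namespace NCSeries

variable {d : ℕ}

noncomputable instance : AddCommGroup (NCSeries d) :=
  inferInstanceAs (AddCommGroup (List (Fin d) → ℂ))

noncomputable instance : Module ℂ (NCSeries d) :=
  inferInstanceAs (Module ℂ (List (Fin d) → ℂ))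

@[ext]
theorem ext {f g : NCSeries d} (h : ∀ w, f w = g w) : f = g := funext h

theorem zero_apply (w : List (Fin d)) : (0 : NCSeries d) w = 0 := rfl
theorem add_apply (f g : NCSeries d) (w : List (Fin d)) : (f + g) w = f w + g w := rfl
theorem neg_apply (f : NCSeries d) (w : List (Fin d)) : (-f) w = -f w := rfl
theorem sub_apply (f g : NCSeries d) (w : List (Fin d)) : (f - g) w = f w - g w := rfl
theorem smul_apply (c : ℂ) (f : NCSeries d) (w : List (Fin d)) : (c • f) w = c * f w := rfl

/-- The product of series: sum over all ways to cut the word in two. -/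
noncomputable instance : Mul (NCSeries d) :=
  ⟨fun f g w => ∑ i ∈ Finset.range (w.length + 1), f (w.take i) * g (w.drop i)⟩

noncomputable instance : One (NCSeries d) := ⟨fun w => if w = [] then 1 else 0⟩

theorem mul_apply (f g : NCSeries d) (w : List (Fin d)) :
    (f * g) w = ∑ i ∈ Finset.range (w.length + 1), f (w.take i) * g (w.drop i) := rfl

theorem one_apply (w : List (Fin d)) : (1 : NCSeries d) w = if w = [] then 1 else 0 := rfl

/-- The left partial derivative: `D i (z_i z_u) = z_u`, `D i (z_j z_u) = 0` for `j ≠ i`,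
`D i 1 = 0`. -/
def D (i : Fin d) (f : NCSeries d) : NCSeries d := fun w => f (i :: w)

theorem D_apply (i : Fin d) (f : NCSeries d) (w : List (Fin d)) : D i f w = f (i :: w) := rfl

theorem mul_nil (f g : NCSeries d) : (f * g) [] = f [] * g [] := by
  simp [mul_apply]

theorem mul_cons (f g : NCSeries d) (a : Fin d) (w : List (Fin d)) :
    (f * g) (a :: w) = (D a f * g) w + f [] * g (a :: w) := by
  rw [mul_apply, mul_apply, List.length_cons, Finset.sum_range_succ']
  simp [D_apply]

theorem D_mul (a : Fin d) (f g : NCSeries d) : D a (f * g) = D a f * g + f [] • D a g := by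
  ext w
  rw [D_apply, mul_cons, add_apply, smul_apply, D_apply]

protected theorem add_mul' (f g h : NCSeries d) : (f + g) * h = f * h + g * h := by
  ext w
  simp only [mul_apply, add_apply, add_mul, Finset.sum_add_distrib]

protected theorem mul_add' (f g h : NCSeries d) : f * (g + h) = f * g + f * h := by
  ext w
  simp only [mul_apply, add_apply, mul_add, Finset.sum_add_distrib]

protected theorem smul_mul' (c : ℂ) (f g : NCSeries d) : (c • f) * g = c • (f * g) := by
  ext w
  simp only [mul_apply, smul_apply, Finset.mul_sum, mul_assoc]

protected theorem zero_mul' (f : NCSeries d) : 0 * f = 0 := by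
  ext w
  simp [mul_apply, zero_apply]

protected theorem mul_zero' (f : NCSeries d) : f * 0 = 0 := by
  ext w
  simp [mul_apply, zero_apply]

theorem D_one (a : Fin d) : D a (1 : NCSeries d) = 0 := by
  ext w
  simp [D_apply, one_apply, zero_apply]

protected theorem one_mul' (f : NCSeries d) : 1 * f = f := by
  ext w
  cases w with
  | nil => simp [mul_nil, one_apply]
  | cons a w => rw [mul_cons, D_one, NCSeries.zero_mul']; simp [zero_apply, one_apply]

protected theorem mul_one' (f : NCSeries d) : f * 1 = f := by
  ext w
  induction w generalizing f with
  | nil => simp [mul_nil, one_apply]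
  | cons a w ih => rw [mul_cons, ih]; simp [D_apply, one_apply]

protected theorem mul_assoc' (f g h : NCSeries d) : f * g * h = f * (g * h) := by
  ext w
  induction w generalizing f g h with
  | nil => simp [mul_nil, mul_assoc]
  | cons a w ih =>
    rw [mul_cons, mul_cons, mul_cons, D_mul, NCSeries.add_mul', add_apply, ih,
      NCSeries.smul_mul', smul_apply, mul_nil]
    ring

noncomputable instance : Ring (NCSeries d) :=
  { (inferInstance : AddCommGroup (NCSeries d)) with
    mul := (· * ·)
    one := 1
    left_distrib := NCSeries.mul_add'
    right_distrib := NCSeries.add_mul'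
    zero_mul := NCSeries.zero_mul'
    mul_zero := NCSeries.mul_zero'
    mul_assoc := NCSeries.mul_assoc'
    one_mul := NCSeries.one_mul'
    mul_one := NCSeries.mul_one' }

/-- The variable `z_i`. -/
noncomputable def X (i : Fin d) : NCSeries d := fun w => if w = [i] then 1 else 0

/-- Substitution `R(F_1, …, F_d) = ∑_u R_u F_{u(1)} ⋯ F_{u(n)}` of series `F_i` without constant
term. Since the `F_i` have no constant term, words `u` longer than `w` do not contribute to the
coefficient of `w`, so the sum is finite. -/
noncomputable def subst (R : NCSeries d) (F : Fin d → NCSeries d) : NCSeries d :=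
  fun w => ∑ n ∈ Finset.range (w.length + 1), ∑ u : Fin n → Fin d,
    R (List.ofFn u) * ((List.ofFn fun k => F (u k)).prod : NCSeries d) w

/-! #### Fixed points of maps that raise the order of agreement -/

/-- Agreement of the coefficients of all words of length less than `n`. -/
def Agree (n : ℕ) (f g : NCSeries d) : Prop := ∀ w : List (Fin d), w.length < n → f w = g w

theorem existsUnique_fixed (F : NCSeries d → NCSeries d)
    (hF : ∀ n f g, Agree n f g → Agree (n + 1) (F f) (F g)) : ∃! f, f = F f := by
  have h1 : ∀ k, Agree k (F^[k] 0) (F^[k + 1] 0) := by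
    intro k
    induction k with
    | zero => intro w hw; exact absurd hw (Nat.not_lt_zero _)
    | succ k ih =>
      rw [Function.iterate_succ_apply', Function.iterate_succ_apply' F (k + 1)]
      exact hF _ _ _ ih
  have h2 : ∀ k m, Agree k (F^[k] 0) (F^[k + m] 0) := by
    intro k m
    induction m with
    | zero => intro w _; rfl
    | succ m ih =>
      intro w hw
      rw [ih w hw]
      exact h1 (k + m) w (by omega)
  refine ⟨fun w => (F^[w.length + 1] 0) w, ?_, ?_⟩
  · ext w
    have h3 : Agree w.length (F^[w.length] 0) (fun v => (F^[v.length + 1] 0) v) := by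
      intro v hv
      have := h2 (v.length + 1) (w.length - (v.length + 1)) v (Nat.lt_succ_self _)
      rw [show v.length + 1 + (w.length - (v.length + 1)) = w.length by omega] at this
      exact this.symm
    have h4 := hF _ _ _ h3 w (Nat.lt_succ_self _)
    rw [← h4, ← Function.iterate_succ_apply' F]
  · intro g hg
    have h5 : ∀ k, Agree k (F^[k] 0) g := by
      intro k
      induction k with
      | zero => intro w hw; exact absurd hw (Nat.not_lt_zero _)
      | succ k ih =>
        have := hF _ _ _ ih
        rw [← hg, ← Function.iterate_succ_apply' F] at this
        exact this
    ext w
    exact (h5 (w.length + 1) w (Nat.lt_succ_self _)).symm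

theorem agree_mul {n : ℕ} {f f' g g' : NCSeries d} (hf : Agree n f f') (hg : Agree n g g') :
    Agree n (f * g) (f' * g') := by
  intro w hw
  rw [mul_apply, mul_apply]
  refine Finset.sum_congr rfl fun i _ => ?_
  rw [hf _ (lt_of_le_of_lt (List.length_take_le' _ _) hw),
    hg _ (lt_of_le_of_lt (by simp) hw)]

theorem agree_mul_left {n : ℕ} {f g g' : NCSeries d} (hf : f [] = 0) (hg : Agree n g g') :
    Agree (n + 1) (f * g) (f * g') := by
  intro w hw
  rw [mul_apply, mul_apply]
  refine Finset.sum_congr rfl fun i hi => ?_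
  rcases Nat.eq_zero_or_pos i with rfl | hi0
  · simp [hf]
  · rcases w with _ | ⟨a, w⟩
    · simp [hf]
    · rw [hg _ (by simp at hw ⊢; omega)]

theorem agree_mul_right {n : ℕ} {f g g' : NCSeries d} (hf : f [] = 0) (hg : Agree n g g') :
    Agree (n + 1) (g * f) (g' * f) := by
  intro w hw
  rw [mul_apply, mul_apply]
  refine Finset.sum_congr rfl fun i hi => ?_
  rcases Nat.lt_or_ge i w.length with h | h
  · rw [hg _ (by simp; omega)]
  · rw [List.drop_eq_nil_of_le h, hf, mul_zero, mul_zero]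

/-- A series with constant term `1` is invertible. -/
theorem isUnit_one_add {f : NCSeries d} (hf : f [] = 0) : IsUnit (1 + f) := by
  obtain ⟨g, hg, -⟩ := existsUnique_fixed (fun g => 1 - f * g) (by
    intro n g g' h w hw
    rw [sub_apply, sub_apply, agree_mul_left hf h w hw])
  obtain ⟨k, hk, -⟩ := existsUnique_fixed (fun g => 1 - g * f) (by
    intro n g g' h w hw
    rw [sub_apply, sub_apply, agree_mul_right hf h w hw])
  have h1 : (1 + f) * g = 1 := by
    rw [add_mul, one_mul]; nth_rewrite 1 [hg]; abel
  have h2 : k * (1 + f) = 1 := by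
    rw [mul_add, mul_one]; nth_rewrite 1 [hk]; abel
  have h3 : k = g := left_inv_eq_right_inv h2 h1
  exact ⟨⟨1 + f, g, h1, h3 ▸ h2⟩, rfl⟩

/-- The change of variables `z_i = (1 + M(w)) w_i`. -/
noncomputable def chg (M : NCSeries d) (i : Fin d) : NCSeries d := (1 + M) * X i

theorem X_nil (i : Fin d) : (X i : NCSeries d) [] = 0 := by simp [X]

theorem chg_nil (M : NCSeries d) (i : Fin d) : chg M i [] = 0 := by
  rw [chg, mul_nil, X_nil, mul_zero]

theorem agree_chg {n : ℕ} {M M' : NCSeries d} (h : Agree n M M') (i : Fin d) :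
    Agree (n + 1) (chg M i) (chg M' i) :=
  agree_mul_right (X_nil i) fun w hw => by rw [add_apply, add_apply, h w hw]

theorem agree_prod {n : ℕ} {M M' : NCSeries d} (h : Agree n M M') (u : List (Fin d)) :
    Agree (n + 1) (u.map (chg M)).prod (u.map (chg M')).prod := by
  induction u with
  | nil => intro w _; rfl
  | cons a u ih =>
    rw [List.map_cons, List.map_cons, List.prod_cons, List.prod_cons]
    exact agree_mul (agree_chg h a) ih

theorem ofFn_chg (M : NCSeries d) {n : ℕ} (u : Fin n → Fin d) :
    (List.ofFn fun k => chg M (u k)) = (List.ofFn u).map (chg M) := by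
  rw [List.map_ofFn]; rfl

/-- A free cumulant series determines the moment series. -/
theorem existsUnique_moment (R : NCSeries d) : ∃! M : NCSeries d, M = subst R (chg M) := by
  refine existsUnique_fixed (fun M => subst R (chg M)) ?_
  intro n M M' h w hw
  refine Finset.sum_congr rfl fun m _ => Finset.sum_congr rfl fun u _ => ?_
  rw [ofFn_chg, ofFn_chg, agree_prod h _ w hw]

theorem prod_chg_low (M : NCSeries d) (u w : List (Fin d)) (h : w.length < u.length) :
    (u.map (chg M)).prod w = 0 := by
  induction u generalizing w with
  | nil => simp at h
  | cons a u ih =>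
    rw [List.map_cons, List.prod_cons, mul_apply]
    refine Finset.sum_eq_zero fun i _ => ?_
    rcases Nat.eq_zero_or_pos i with rfl | hi
    · simp [chg_nil]
    · rcases w with _ | ⟨b, w⟩
      · simp [chg_nil]
      · rw [ih _ (by simp at h ⊢; omega), mul_zero]

theorem prod_chg_top (M : NCSeries d) (hM : M [] = 0) (u w : List (Fin d))
    (h : w.length = u.length) : (u.map (chg M)).prod w = if u = w then 1 else 0 := by
  induction u generalizing w with
  | nil => simp at h; subst h; simp [one_apply]
  | cons a u ih =>
    rcases w with _ | ⟨b, w⟩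
    · simp at h
    · have hw : w.length = u.length := by simpa using h
      rw [List.map_cons, List.prod_cons, mul_cons, chg_nil, zero_mul, add_zero, mul_apply,
        Finset.sum_eq_single 0]
      · have h1 : D b (chg M a) [] = if a = b then 1 else 0 := by
          rw [D_apply, chg, mul_cons, mul_nil, X_nil, mul_zero, zero_add, add_apply, hM]
          simp [one_apply, X, eq_comm]
        simp only [List.take_zero, List.drop_zero]
        rw [h1, ih w hw]
        by_cases hab : a = b <;> by_cases huw : u = w <;> simp [hab, huw]
      · intro i hi hi0
        rcases w with _ | ⟨c, w⟩
        · simp at hi; omega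
        · rw [prod_chg_low _ _ _ (by simp at hw ⊢; omega), mul_zero]
      · simp

/-- A moment series determines the free cumulant series. -/
theorem existsUnique_cumulant (M : NCSeries d) (hM : M [] = 0) :
    ∃! R : NCSeries d, M = subst R (chg M) := by
  have key := existsUnique_fixed (d := d) (fun R => fun w => M w -
    ∑ n ∈ Finset.range w.length, ∑ u : Fin n → Fin d,
      R (List.ofFn u) * ((List.ofFn fun k => chg M (u k)).prod : NCSeries d) w) (by
    intro n f g h w hw
    simp only
    congr 1
    refine Finset.sum_congr rfl fun m hm => Finset.sum_congr rfl fun u _ => ?_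
    rw [h _ (by simp at hm ⊢; omega)])
  have top : ∀ (R : NCSeries d) (w : List (Fin d)), (∑ u : Fin w.length → Fin d,
      R (List.ofFn u) * ((List.ofFn fun k => chg M (u k)).prod : NCSeries d) w) = R w := by
    intro R w
    rw [Finset.sum_eq_single w.get]
    · rw [ofFn_chg, prod_chg_top M hM _ _ (by simp)]; simp
    · intro u _ hu
      rw [ofFn_chg, prod_chg_top M hM _ _ (by simp), if_neg, mul_zero]
      intro h
      exact hu (List.ofFn_injective (h.trans (List.ofFn_get w).symm))
    · simp
  have equiv : ∀ R : NCSeries d, M = subst R (chg M) ↔ R = fun w => M w -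
    ∑ n ∈ Finset.range w.length, ∑ u : Fin n → Fin d,
      R (List.ofFn u) * ((List.ofFn fun k => chg M (u k)).prod : NCSeries d) w := by
    intro R
    constructor
    · intro h
      ext w
      have := congrFun h w
      rw [subst, Finset.sum_range_succ, top] at this
      rw [this]; ring
    · intro h
      ext w
      rw [subst, Finset.sum_range_succ, top]
      have := congrFun h w
      rw [this]; ring
  simpa only [equiv] using key

/-- The free cumulant series `R` of a moment series `M` (without constant term), defined by
the implicit equation `M(w) = R((1 + M(w)) w)`. -/
noncomputable def freeCumulant (M : NCSeries d) (hM : M [] = 0) : NCSeries d :=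
  (existsUnique_cumulant M hM).choose

/-- The moment series `M` with given free cumulant series `R`: `M(w) = R((1 + M(w)) w)`. -/
noncomputable def momentOfFree (R : NCSeries d) : NCSeries d := (existsUnique_moment R).choose

end NCSeries

/-! ### Functionals on non-commutative polynomials -/

/-- Linear functionals on `ℂ⟨x_1, …, x_d⟩`. -/
abbrev NCFunctional (d : ℕ) : Type := FreeAlgebra ℂ (Fin d) →ₗ[ℂ] ℂ

namespace NCFunctional

open NCSeries

variable {d : ℕ}

/-- The monomial `x_u` of a word `u`. -/
noncomputable def monomial (u : List (Fin d)) : FreeAlgebra ℂ (Fin d) :=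
  (u.map (FreeAlgebra.ι ℂ)).prod

/-- The unital functional with prescribed moments `φ[x_u] = m u` for all non-empty words `u`. -/
noncomputable def ofMoments (m : NCSeries d) : NCFunctional d :=
  (FreeAlgebra.basisFreeMonoid ℂ (Fin d)).constr ℂ
    fun u => if u.toList = [] then 1 else m u.toList

theorem basis_eq_monomial (u : FreeMonoid (Fin d)) :
    FreeAlgebra.basisFreeMonoid ℂ (Fin d) u = monomial u.toList := by
  rw [FreeAlgebra.basisFreeMonoid, Module.Basis.map_apply, Finsupp.coe_basisSingleOne]
  change MonoidAlgebra.lift ℂ (FreeAlgebra ℂ (Fin d)) (FreeMonoid (Fin d))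
    (FreeMonoid.lift (FreeAlgebra.ι ℂ)) (MonoidAlgebra.single u 1) = _
  rw [MonoidAlgebra.lift_single, one_smul, FreeMonoid.lift_apply, monomial]

theorem ofMoments_monomial (m : NCSeries d) (u : List (Fin d)) :
    ofMoments m (monomial u) = if u = [] then 1 else m u := by
  have := basis_eq_monomial (FreeMonoid.ofList u)
  rw [FreeMonoid.toList_ofList] at this
  rw [← this, ofMoments, Module.Basis.constr_basis, FreeMonoid.toList_ofList]

/-- The moment generating function `M^φ(z) = ∑ φ[x_u] z_u`, over non-empty words `u`. -/
noncomputable def M (φ : NCFunctional d) : NCSeries d :=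
  fun u => if u = [] then 0 else φ (monomial u)

theorem M_nil (φ : NCFunctional d) : φ.M [] = 0 := by simp [M]

/-- The Boolean cumulant generating function `η^φ = 1 - (1 + M^φ)⁻¹`. -/
noncomputable def eta (φ : NCFunctional d) : NCSeries d := 1 - Ring.inverse (1 + φ.M)

/-- The free cumulant generating function `R^φ`, with `M^φ(w) = R^φ((1 + M^φ(w)) w)`. -/
noncomputable def R (φ : NCFunctional d) : NCSeries d := freeCumulant φ.M φ.M_nil

/-- The unital functional with Boolean cumulant generating function `h` (a series without
constant term): its moment generating function is `(1 - h)⁻¹ - 1`. -/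
noncomputable def ofEta (h : NCSeries d) : NCFunctional d := ofMoments (Ring.inverse (1 - h) - 1)

/-- The unital functional with free cumulant generating function `r` (a series without constant
term). -/
noncomputable def ofR (r : NCSeries d) : NCFunctional d := ofMoments (momentOfFree r)

/-- The free convolution `φ ⊞ ψ`. -/
noncomputable def boxplus (φ ψ : NCFunctional d) : NCFunctional d := ofR (φ.R + ψ.R)

/-- The Boolean convolution `φ ⊎ ψ`. -/
noncomputable def uplus (φ ψ : NCFunctional d) : NCFunctional d := ofEta (φ.eta + ψ.eta)

/-- The free convolution power `φ^{⊞ t}`, as a functional, for real `t`. -/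
noncomputable def boxpow (φ : NCFunctional d) (t : ℝ) : NCFunctional d := ofR ((t : ℂ) • φ.R)

/-- The Boolean convolution power `φ^{⊎ t}`, as a functional, for real `t`. -/
noncomputable def upow (φ : NCFunctional d) (t : ℝ) : NCFunctional d := ofEta ((t : ℂ) • φ.eta)

/-- The functional `δ_a[P] = P(a_1, …, a_d)`. -/
noncomputable def delta (a : Fin d → ℝ) : NCFunctional d :=
  (FreeAlgebra.lift ℂ fun i => (a i : ℂ)).toLinearMap

/-- The functional `Φ[ρ, ψ]`, with `η^{Φ[ρ, ψ]}(w) = (1 + M^ψ(w))⁻¹ R^ρ((1 + M^ψ(w)) w)`. -/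
noncomputable def Phi (ρ ψ : NCFunctional d) : NCFunctional d :=
  ofEta (Ring.inverse (1 + ψ.M) * subst ρ.R (chg ψ.M))

/-- The transformation `B_{a, t}[ρ] = ((ρ^{⊞ (1 + t)} ⊞ δ_a) ⊎ δ_{-a})^{⊎ 1 / (1 + t)}`,
for `t ≠ -1`. -/
noncomputable def BT (a : Fin d → ℝ) (t : ℝ) (ρ : NCFunctional d) : NCFunctional d :=
  (((ρ.boxpow (1 + t)).boxplus (delta a)).uplus (delta (-a))).upow (1 / (1 + t))

/-- The involution of `ℂ⟨x_1, …, x_d⟩`: conjugate-linear, reversing monomials, `x_i^* = x_i`. -/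
noncomputable def adj (P : FreeAlgebra ℂ (Fin d)) : FreeAlgebra ℂ (Fin d) :=
  ((FreeAlgebra.basisFreeMonoid ℂ (Fin d)).repr P).sum
    fun u c => starRingEnd ℂ c • monomial u.toList.reverse

/-- States: unital, `*`-compatible, positive functionals. (By `*`-compatibility `φ[P^* P]` is
real.) -/
structure IsState (φ : NCFunctional d) : Prop where
  unital : φ 1 = 1
  star_compat : ∀ P, φ (adj P) = starRingEnd ℂ (φ P)
  nonneg : ∀ P, 0 ≤ (φ (adj P * P)).re

/-- `φ` is the free Meixner state `φ_{{T_i}, C}` (normalized to mean zero; the equation for the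
constant terms then says that the covariance is the identity). Here `T i j k = B_{ij}^k`, so
`T_i` is a `d × d` matrix, and `C` stands for the diagonal operator
`e_i ⊗ e_j ↦ C_{ij} e_i ⊗ e_j` on `ℂ^d ⊗ ℂ^d`. The product on the right is that of series. -/
structure IsFreeMeixnerState (T : Fin d → Matrix (Fin d) (Fin d) ℂ)
    (C : Matrix (Fin d) (Fin d) ℝ) (φ : NCFunctional d) : Prop where
  isState : IsState φ
  mean_zero : ∀ i, φ (FreeAlgebra.ι ℂ i) = 0
  quadratic : ∀ i j, D i (D j φ.R) = (if i = j then 1 else 0) + ∑ k, T i j k • D k φ.R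
    + (C i j : ℂ) • (D i φ.R * D j φ.R)

/-- The functional on `ℂ⟨x_1⟩` given by integration against a measure on `ℝ`. -/
noncomputable def ofMeasure (μ : Measure ℝ) : NCFunctional 1 :=
  ofMoments fun u => ((∫ x, x ^ u.length ∂μ : ℝ) : ℂ)

end NCFunctional

/-! ### Free Meixner distributions -/

/-- The monic polynomials with `P_0 = 1`, `P_1 = x - β_0` and
`x P_n = P_{n+1} + β_n P_n + γ_n P_{n-1}`. -/
noncomputable def jacobiPoly (β γ : ℕ → ℝ) : ℕ → Polynomial ℝ
  | 0 => 1
  | 1 => Polynomial.X - Polynomial.C (β 0)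
  | n + 2 => (Polynomial.X - Polynomial.C (β (n + 1))) * jacobiPoly β γ (n + 1)
      - Polynomial.C (γ (n + 1)) * jacobiPoly β γ n

/-- `μ` is a probability measure on `ℝ` with finite moments and with Jacobi parameter sequences
`(β_0, β_1, …)`, `(γ_1, γ_2, …)` (the value `γ 0` is not used): the monic polynomials given by
the three-term recursion are orthogonal with respect to `μ`. -/
structure HasJacobiParameters (β γ : ℕ → ℝ) (μ : Measure ℝ) : Prop where
  isProb : IsProbabilityMeasure μ
  moments : ∀ n : ℕ, Integrable (fun x : ℝ => x ^ n) μ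
  orthogonal : ∀ m n, m ≠ n →
    ∫ x, (jacobiPoly β γ m).eval x * (jacobiPoly β γ n).eval x ∂μ = 0

/-- `μ` is the free Meixner distribution `μ_{b, c}` (mean zero, variance one): its Jacobi
parameter sequences are `(0, b, b, …)` and `(1, 1 + c, 1 + c, …)`. -/
def IsFreeMeixner (b c : ℝ) (μ : Measure ℝ) : Prop :=
  HasJacobiParameters (fun n => if n = 0 then 0 else b) (fun n => if n = 1 then 1 else 1 + c) μ

/-- The Bernoulli distribution `(δ_{-1} + δ_1) / 2`. -/
noncomputable def bernoulliSym : Measure ℝ :=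
  (1 / 2 : ENNReal) • Measure.dirac (-1) + (1 / 2 : ENNReal) • Measure.dirac 1

/-! The free cumulants are traded for the Boolean ones. Every word of `R` starts with some letter
and `1 + M` is the left factor of each `chg M i`, so `(1 + M)⁻¹ R((1 + M) w) = ∑ w_i (D_i R)((1 + M)
w)`. With `M = M^ψ` this gives `D_i η^{Φ[φ, ψ]} = (D_i R^φ)((1 + M^ψ) w)` (`D_eta_Phi`), and `Φ[φ,
φ]` has the Boolean cumulants of `φ` (`D_eta`). If `φ` has zero means, a second application and the
Leibniz rule give `D_i D_j η^{Φ[φ, ψ]} = (D_i D_j R^φ)((1 + M^ψ) w) + D_i η^ψ · D_j η^{Φ[φ, ψ]}`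
(`D_D_inverse_mul_subst`).

For `ψ = φ` the last term turns the quadratic equation of `R^φ` into the same equation for `η^φ`
with `1 + C` in place of `C` (`isBooleanMeixner_eta_iff`). For `ψ = φ^{⊞(1+t)} ⊞ δ_a` one has `η^ψ =
(1 + t) η^{Φ[φ, ψ]} + ∑ a_i w_i`. Hence the same computation yields the Boolean equation with
parameters `a_i I + T_i` and `t + C` (`isBooleanMeixner_eta_Phi`), and, since `⊎ δ_{-a}` removes the
linear term and the Boolean power removes the factor `1 + t`, `Φ[φ, ψ] = B_{a,t}[φ]` for `t ≠ -1`
(`BT_eq_Phi`).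

The Boolean equation is a recursion on coefficients, so it has exactly one solution. Positivity
comes from a Fock space: the solution is the vacuum expectation of `X_i = a_i^+ + T_i + a_i^-`,
symmetric for an inner product with weights built from `1 + C_{ij}`, provided that the `T_i` are
Hermitian and commute with `C`. For a given free Meixner state these two conditions are forced by
`*`-compatibility: they can be read off the Boolean cumulants of orders three and five.

In one variable the Jacobi polynomials of `μ_{b,c}`, evaluated at `X`, send the vacuum to the basis
vectors. So `μ_{b,c}` is the state with `T = b`, `C = c`. It exists as the spectral measure of a
Jacobi operator and is unique because compact support makes the moment problem determinate.
Bernoulli is `μ_{0,-1}`, from which `α = b`, `t = c + 1` reach everything. -/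

namespace NCSeries

variable {d : ℕ}

/-! ### Calculus of left derivatives -/

instance : IsScalarTower ℂ (NCSeries d) (NCSeries d) := ⟨NCSeries.smul_mul'⟩

instance : SMulCommClass ℂ (NCSeries d) (NCSeries d) where
  smul_comm c f g := by
    ext w
    simp only [smul_eq_mul, mul_apply, smul_apply, Finset.mul_sum]
    exact Finset.sum_congr rfl fun i _ => by ring

theorem one_nil : (1 : NCSeries d) [] = 1 := by simp [one_apply]

theorem sum_apply {ι : Type*} (s : Finset ι) (f : ι → NCSeries d) (w : List (Fin d)) :
    (∑ i ∈ s, f i) w = ∑ i ∈ s, f i w := by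
  classical
  induction s using Finset.induction_on with
  | empty => simp [zero_apply]
  | insert a s ha ih => rw [Finset.sum_insert ha, Finset.sum_insert ha, add_apply, ih]

theorem D_add (i : Fin d) (f g : NCSeries d) : D i (f + g) = D i f + D i g := rfl

theorem D_sub (i : Fin d) (f g : NCSeries d) : D i (f - g) = D i f - D i g := rfl

theorem D_smul (i : Fin d) (c : ℂ) (f : NCSeries d) : D i (c • f) = c • D i f := rfl

theorem D_sum {ι : Type*} (i : Fin d) (s : Finset ι) (f : ι → NCSeries d) :
    D i (∑ k ∈ s, f k) = ∑ k ∈ s, D i (f k) := by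
  ext w
  simp only [D_apply, sum_apply]

theorem D_X (i j : Fin d) : D i (X j : NCSeries d) = if i = j then 1 else 0 := by
  ext w
  by_cases h : i = j <;> simp [D_apply, X, h, one_apply, zero_apply]

theorem D_X_mul (i j : Fin d) (f : NCSeries d) :
    D i (X j * f) = if i = j then f else 0 := by
  rw [D_mul, D_X, X_nil, zero_smul, add_zero]
  split_ifs <;> simp

theorem D_sum_X_mul (i : Fin d) (f : Fin d → NCSeries d) : D i (∑ j, X j * f j) = f i := by
  simp [D_sum, D_X_mul]

/-- Two series with the same constant term and the same derivatives agree. -/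
theorem ext_D {f g : NCSeries d} (h0 : f [] = g []) (h : ∀ i, D i f = D i g) : f = g := by
  ext w
  cases w with
  | nil => exact h0
  | cons a w => exact congrFun (h a) w

/-! ### Substitution of `(1 + M) z` -/

theorem subst_chg_apply (M R : NCSeries d) {N : ℕ} {w : List (Fin d)} (hN : w.length < N) :
    subst R (chg M) w = ∑ n ∈ Finset.range N, ∑ u : Fin n → Fin d,
      R (List.ofFn u) * ((List.ofFn u).map (chg M)).prod w := by
  simp only [subst, ofFn_chg]
  refine Finset.sum_subset (Finset.range_mono hN) fun n _ hn => ?_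
  refine Finset.sum_eq_zero fun u _ => ?_
  rw [prod_chg_low, mul_zero]
  simpa using hn

/-- Splitting off the first letter of each word of `R`: a first-order Taylor formula, from which all
properties of the substitution follow. -/
theorem subst_chg_eq (M R : NCSeries d) :
    subst R (chg M) = R [] • 1 + ∑ i, chg M i * subst (D i R) (chg M) := by
  ext w
  have h1 : ∀ i, (chg M i * subst (D i R) (chg M)) w = ∑ n ∈ Finset.range w.length,
      ∑ u : Fin n → Fin d, R (i :: List.ofFn u) *
        (chg M i * ((List.ofFn u).map (chg M)).prod : NCSeries d) w := by
    intro i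
    simp only [mul_apply (chg M i), Finset.mul_sum]
    rw [Finset.sum_congr rfl fun n _ => Finset.sum_comm, Finset.sum_comm]
    refine Finset.sum_congr rfl fun k hk => ?_
    -- A cut at `0` contributes nothing since `chg M i` has no constant term; any other cut leaves a
    -- shorter word, so one truncation bound serves all cuts.
    rcases Nat.eq_zero_or_pos k with rfl | hk0
    · simp [chg_nil]
    · rcases w with _ | ⟨a, w⟩
      · simp [chg_nil]
      · rw [subst_chg_apply M (D i R) (N := (a :: w).length) (by simp; omega), Finset.mul_sum]
        refine Finset.sum_congr rfl fun n _ => ?_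
        rw [Finset.mul_sum]
        refine Finset.sum_congr rfl fun u _ => ?_
        rw [D_apply]; ring
  rw [subst_chg_apply M R (Nat.lt_succ_self _), Finset.sum_range_succ', add_apply, sum_apply,
    Finset.sum_congr rfl fun i _ => h1 i, add_comm, Finset.sum_comm]
  congr 1
  · simp [smul_apply]
  · refine Finset.sum_congr rfl fun n _ => ?_
    rw [← (Fin.consEquiv fun _ => Fin d).sum_comp, Fintype.sum_prod_type]
    refine Finset.sum_congr rfl fun i _ => Finset.sum_congr rfl fun u _ => ?_
    simp [Fin.consEquiv, List.ofFn_succ]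

theorem subst_chg_nil (M R : NCSeries d) : subst R (chg M) [] = R [] := by
  rw [subst_chg_eq]
  simp [add_apply, smul_apply, one_nil, sum_apply, mul_nil, chg_nil]

theorem subst_add (f g : NCSeries d) (F : Fin d → NCSeries d) :
    subst (f + g) F = subst f F + subst g F := by
  ext w
  simp only [subst, add_apply, add_mul, Finset.sum_add_distrib]

theorem subst_smul (c : ℂ) (f : NCSeries d) (F : Fin d → NCSeries d) :
    subst (c • f) F = c • subst f F := by
  ext w
  simp only [subst, smul_apply, Finset.mul_sum, mul_assoc]

theorem subst_zero (F : Fin d → NCSeries d) : subst 0 F = 0 := by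
  ext w
  simp [subst, zero_apply]

theorem subst_sum {ι : Type*} (s : Finset ι) (f : ι → NCSeries d) (F : Fin d → NCSeries d) :
    subst (∑ i ∈ s, f i) F = ∑ i ∈ s, subst (f i) F := by
  classical
  induction s using Finset.induction_on with
  | empty => simp [subst_zero]
  | insert a s ha ih => rw [Finset.sum_insert ha, Finset.sum_insert ha, subst_add, ih]

theorem subst_chg_one (M : NCSeries d) : subst 1 (chg M) = 1 := by
  rw [subst_chg_eq]
  simp [one_nil, D_one, subst_zero]

theorem subst_chg_X (M : NCSeries d) (i : Fin d) : subst (X i) (chg M) = chg M i := by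
  rw [subst_chg_eq, X_nil, zero_smul, zero_add, Finset.sum_eq_single i]
  · rw [D_X, if_pos rfl, subst_chg_one, mul_one]
  · intro j _ hj
    rw [D_X, if_neg hj, subst_zero, mul_zero]
  · simp

/-- Expanding by the first letter of `f` reduces the claim to `D i f` and `g`, behind a factor `chg
M i`. That factor has no constant term and so raises the order of agreement by one. -/
theorem subst_chg_mul (M f g : NCSeries d) :
    subst (f * g) (chg M) = subst f (chg M) * subst g (chg M) := by
  have key : ∀ n (f g : NCSeries d),
      Agree n (subst (f * g) (chg M)) (subst f (chg M) * subst g (chg M)) := by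
    intro n
    induction n with
    | zero => intro f g w hw; exact absurd hw (Nat.not_lt_zero _)
    | succ n ih =>
      intro f g w hw
      have h1 : subst (f * g) (chg M) =
          f [] • subst g (chg M) + ∑ i, chg M i * subst (D i f * g) (chg M) := by
        rw [subst_chg_eq M (f * g), subst_chg_eq M g, mul_nil]
        simp only [D_mul, subst_add, subst_smul, mul_add, Finset.sum_add_distrib, smul_add,
          mul_smul, mul_smul_comm, Finset.smul_sum]
        abel
      have h2 : subst f (chg M) * subst g (chg M) = f [] • subst g (chg M) +
          ∑ i, chg M i * (subst (D i f) (chg M) * subst g (chg M)) := by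
        rw [subst_chg_eq M f, add_mul, Finset.sum_mul, smul_mul_assoc, one_mul]
        simp only [mul_assoc]
      rw [h1, h2, add_apply, add_apply, sum_apply, sum_apply]
      congr 1
      exact Finset.sum_congr rfl fun i _ => agree_mul_left (chg_nil M i) (ih _ _) w hw
  ext w
  exact key _ f g w (Nat.lt_succ_self _)

theorem inverse_mul_subst {M : NCSeries d} (hM : M [] = 0) {R : NCSeries d} (hR : R [] = 0) :
    Ring.inverse (1 + M) * subst R (chg M) = ∑ i, X i * subst (D i R) (chg M) := by
  rw [subst_chg_eq, hR, zero_smul, zero_add, Finset.mul_sum]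
  refine Finset.sum_congr rfl fun i _ => ?_
  rw [chg, mul_assoc, Ring.inverse_mul_cancel_left _ _ (isUnit_one_add hM)]

/-- The inverse cancels the factor `1 + M` of each `chg M i`, leaving the bare letter for `D i` to
strip. This is the mechanism behind the whole proof. -/
theorem D_inverse_mul_subst {M : NCSeries d} (hM : M [] = 0) {R : NCSeries d} (hR : R [] = 0)
    (i : Fin d) : D i (Ring.inverse (1 + M) * subst R (chg M)) = subst (D i R) (chg M) := by
  rw [inverse_mul_subst hM hR, D_sum_X_mul]

/-- The substituted series determines the constant term and the substituted derivatives, so the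
coefficients are recovered letter by letter. -/
theorem subst_chg_injective {M : NCSeries d} (hM : M [] = 0) {f g : NCSeries d}
    (h : subst f (chg M) = subst g (chg M)) : f = g := by
  have key : ∀ (w : List (Fin d)) (f g : NCSeries d), subst f (chg M) = subst g (chg M) →
      f w = g w := by
    intro w
    induction w with
    | nil => intro f g h; rw [← subst_chg_nil M f, h, subst_chg_nil]
    | cons a w ih =>
      intro f g h
      refine ih (D a f) (D a g) ?_
      have h0 : f [] = g [] := by rw [← subst_chg_nil M f, h, subst_chg_nil]
      have hs : ∀ k : NCSeries d, subst (D a k) (chg M) =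
          D a (Ring.inverse (1 + M) * (subst k (chg M) + (-k []) • 1)) := by
        intro k
        have h1 := D_inverse_mul_subst hM (R := k + (-k []) • 1)
          (by rw [add_apply, smul_apply, one_nil]; ring) a
        rw [D_add, D_smul, D_one, smul_zero, add_zero, subst_add, subst_smul,
          subst_chg_one] at h1
        rw [← h1]
      rw [hs, hs, h, h0]
  ext w
  exact key w f g h

end NCSeries

/-! ### The quadratic equation of the Boolean cumulants -/

namespace NCSeries

variable {d : ℕ}

theorem isUnit_one_sub {h : NCSeries d} (hh : h [] = 0) : IsUnit (1 - h) := by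
  rw [sub_eq_add_neg]
  exact isUnit_one_add (by rw [neg_apply, hh, neg_zero])

theorem inverse_nil {f : NCSeries d} (hf : IsUnit f) (h0 : f [] = 1) :
    Ring.inverse f [] = 1 := by
  have h := congrFun (Ring.mul_inverse_cancel f hf) []
  rwa [mul_nil, h0, one_mul, one_nil] at h

theorem sum_smul_X_nil (a : Fin d → ℂ) : (∑ i, a i • X i : NCSeries d) [] = 0 := by
  rw [sum_apply]
  exact Finset.sum_eq_zero fun i _ => by rw [smul_apply, X_nil, mul_zero]

theorem D_sum_smul_X (a : Fin d → ℂ) (i : Fin d) :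
    D i (∑ j, a j • X j : NCSeries d) = a i • 1 := by
  simp [D_sum, D_smul, D_X]

/-- A series `h` without terms of order less than two that satisfies the quadratic equation for
the Boolean cumulant series of the free Meixner state with parameters `T` and `C`. -/
structure IsBooleanMeixner (T : Fin d → Matrix (Fin d) (Fin d) ℂ)
    (C : Matrix (Fin d) (Fin d) ℝ) (h : NCSeries d) : Prop where
  nil : h [] = 0
  singleton : ∀ i, h [i] = 0
  quadratic : ∀ i j, D i (D j h) = (if i = j then 1 else 0) + ∑ k, T i j k • D k h
    + ((1 + C i j : ℝ) : ℂ) • (D i h * D j h)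

/-- The equation expresses the coefficient of `j :: i :: v` through coefficients of words of length
at most `v.length + 1`, so it is a recursion. -/
theorem existsUnique_isBooleanMeixner (T : Fin d → Matrix (Fin d) (Fin d) ℂ)
    (C : Matrix (Fin d) (Fin d) ℝ) : ∃! h, IsBooleanMeixner T C h := by
  let F : NCSeries d → NCSeries d := fun h w => match w with
    | [] => 0
    | [_] => 0
    | j :: i :: v => ((if i = j then 1 else 0) + ∑ k, T i j k • D k h
        + ((1 + C i j : ℝ) : ℂ) • (D i h * D j h) : NCSeries d) v
  have hF : ∀ n f g, Agree n f g → Agree (n + 1) (F f) (F g) := by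
    intro n f g h w hw
    match w, hw with
    | [], _ => rfl
    | [_], _ => rfl
    | j :: i :: v, hw =>
      have hv : v.length + 1 < n := by simpa using hw
      have hD : ∀ k, Agree (v.length + 1) (D k f) (D k g) := by
        intro k u hu
        exact h (k :: u) (by simp; omega)
      change ((if i = j then 1 else 0) + ∑ k, T i j k • D k f
        + ((1 + C i j : ℝ) : ℂ) • (D i f * D j f) : NCSeries d) v =
        ((if i = j then 1 else 0) + ∑ k, T i j k • D k g
        + ((1 + C i j : ℝ) : ℂ) • (D i g * D j g) : NCSeries d) v
      rw [add_apply, add_apply, add_apply, add_apply, smul_apply, smul_apply,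
        agree_mul (hD i) (hD j) v (Nat.lt_succ_self _), sum_apply, sum_apply]
      congr 2
      refine Finset.sum_congr rfl fun k _ => ?_
      rw [smul_apply, smul_apply, hD k v (Nat.lt_succ_self _)]
  have hiff : ∀ h, h = F h ↔ IsBooleanMeixner T C h := by
    intro h
    constructor
    · intro e
      refine ⟨congrFun e [], fun i => congrFun e [i], fun i j => ?_⟩
      ext v
      exact congrFun e (j :: i :: v)
    · intro e
      ext w
      match w with
      | [] => exact e.nil
      | [i] => exact e.singleton i
      | j :: i :: v => exact congrFun (e.quadratic i j) v
  simpa only [hiff] using existsUnique_fixed F hF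

end NCSeries

/-! ### Moments, Boolean cumulants and free cumulants of functionals -/

namespace NCFunctional

open NCSeries

variable {d : ℕ}

theorem monomial_nil : monomial ([] : List (Fin d)) = 1 := rfl

theorem monomial_append (u v : List (Fin d)) : monomial (u ++ v) = monomial u * monomial v := by
  simp [monomial]

theorem ext_monomial {V : Type*} [AddCommGroup V] [Module ℂ V]
    {f g : FreeAlgebra ℂ (Fin d) →ₗ[ℂ] V} (h : ∀ u, f (monomial u) = g (monomial u)) :
    f = g := by
  refine (FreeAlgebra.basisFreeMonoid ℂ (Fin d)).ext fun u => ?_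
  rw [basis_eq_monomial, h]

theorem ext_M {φ ψ : NCFunctional d} (hφ : φ 1 = 1) (hψ : ψ 1 = 1) (h : φ.M = ψ.M) : φ = ψ := by
  refine ext_monomial fun u => ?_
  by_cases hu : u = []
  · rw [hu, monomial_nil, hφ, hψ]
  · simpa [M, hu] using congrFun h u

theorem ofMoments_one (m : NCSeries d) : ofMoments m 1 = 1 := by
  rw [← monomial_nil, ofMoments_monomial, if_pos rfl]

theorem M_ofMoments {m : NCSeries d} (hm : m [] = 0) : (ofMoments m).M = m := by
  ext u
  by_cases hu : u = []
  · simp [M, hu, hm]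
  · simp [M, hu, ofMoments_monomial]

theorem isUnit_one_add_M (φ : NCFunctional d) : IsUnit (1 + φ.M) := isUnit_one_add φ.M_nil

theorem one_sub_eta (φ : NCFunctional d) : 1 - φ.eta = Ring.inverse (1 + φ.M) := by
  rw [eta, sub_sub_cancel]

theorem eta_nil (φ : NCFunctional d) : φ.eta [] = 0 := by
  rw [eta, sub_apply, inverse_nil φ.isUnit_one_add_M, one_nil, sub_self]
  rw [add_apply, M_nil, one_nil, add_zero]

theorem one_sub_eta_mul (φ : NCFunctional d) : (1 - φ.eta) * (1 + φ.M) = 1 := by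
  rw [one_sub_eta, Ring.inverse_mul_cancel _ φ.isUnit_one_add_M]

theorem one_add_M_mul (φ : NCFunctional d) : (1 + φ.M) * (1 - φ.eta) = 1 := by
  rw [one_sub_eta, Ring.mul_inverse_cancel _ φ.isUnit_one_add_M]

theorem eta_eq_of_mul {φ : NCFunctional d} {h : NCSeries d} (H : (1 - h) * (1 + φ.M) = 1) :
    φ.eta = h := by
  have := left_inv_eq_right_inv H φ.one_add_M_mul
  exact (sub_right_injective this).symm

theorem ext_eta {φ ψ : NCFunctional d} (hφ : φ 1 = 1) (hψ : ψ 1 = 1) (h : φ.eta = ψ.eta) :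
    φ = ψ := by
  refine ext_M hφ hψ ?_
  have h1 := φ.one_add_M_mul
  rw [h] at h1
  exact add_left_cancel (left_inv_eq_right_inv h1 ψ.one_sub_eta_mul)

theorem ofEta_one (h : NCSeries d) : ofEta h 1 = 1 := ofMoments_one _

theorem one_add_M_ofEta {h : NCSeries d} (hh : h [] = 0) :
    1 + (ofEta h).M = Ring.inverse (1 - h) := by
  rw [ofEta, M_ofMoments, add_sub_cancel]
  rw [sub_apply, inverse_nil (isUnit_one_sub hh), one_nil, sub_self]
  rw [sub_apply, hh, one_nil, sub_zero]

theorem eta_ofEta {h : NCSeries d} (hh : h [] = 0) : (ofEta h).eta = h := by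
  apply eta_eq_of_mul
  rw [one_add_M_ofEta hh, Ring.mul_inverse_cancel _ (isUnit_one_sub hh)]

theorem M_eq_subst (φ : NCFunctional d) : φ.M = subst φ.R (chg φ.M) :=
  (existsUnique_cumulant φ.M φ.M_nil).choose_spec.1

theorem R_eq_of_subst {φ : NCFunctional d} {r : NCSeries d} (h : φ.M = subst r (chg φ.M)) :
    φ.R = r :=
  ((existsUnique_cumulant φ.M φ.M_nil).choose_spec.2 r h).symm

theorem R_nil (φ : NCFunctional d) : φ.R [] = 0 := by
  have h := subst_chg_nil φ.M φ.R
  rw [← h, ← M_eq_subst, M_nil]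

theorem R_ofR {r : NCSeries d} (hr : r [] = 0) : (ofR r).R = r := by
  have h : momentOfFree r = subst r (chg (momentOfFree r)) :=
    (existsUnique_moment r).choose_spec.1
  apply R_eq_of_subst
  rw [ofR, M_ofMoments, ← h]
  rw [h, subst_chg_nil, hr]

theorem eta_eq_inverse_mul_subst (φ : NCFunctional d) :
    φ.eta = Ring.inverse (1 + φ.M) * subst φ.R (chg φ.M) := by
  rw [← M_eq_subst, ← one_sub_eta]
  have := φ.one_sub_eta_mul
  rw [mul_add, mul_one] at this
  rw [← sub_eq_iff_eq_add'.mpr this.symm]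
  abel

theorem D_eta (φ : NCFunctional d) (i : Fin d) : D i φ.eta = subst (D i φ.R) (chg φ.M) := by
  rw [eta_eq_inverse_mul_subst, D_inverse_mul_subst φ.M_nil φ.R_nil]

/-- Point evaluation is multiplicative, so its moment series is geometric; both kinds of cumulants
are therefore linear. -/
theorem delta_M (a : Fin d → ℝ) :
    (delta a).M = (∑ i, (a i : ℂ) • X i) * (1 + (delta a).M) := by
  apply ext_D
  · rw [M_nil, mul_nil, sum_smul_X_nil, zero_mul]
  · intro i
    rw [D_mul, sum_smul_X_nil, zero_smul, add_zero, D_sum_smul_X, smul_mul_assoc, one_mul]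
    ext w
    rw [D_apply, NCSeries.smul_apply, NCSeries.add_apply, one_apply]
    by_cases hw : w = []
    · simp [M, hw, monomial, delta]
    · simp [M, hw, monomial, delta]

theorem eta_delta (a : Fin d → ℝ) : (delta a).eta = ∑ i, (a i : ℂ) • X i := by
  apply eta_eq_of_mul
  rw [sub_mul, ← delta_M, one_mul, add_sub_cancel_right]

theorem R_delta (a : Fin d → ℝ) : (delta a).R = ∑ i, (a i : ℂ) • X i := by
  apply R_eq_of_subst
  have h : (1 + (delta a).M) * (1 - ∑ i, (a i : ℂ) • X i) = 1 := by
    rw [← eta_delta, one_add_M_mul]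
  rw [mul_sub, mul_one, sub_eq_iff_eq_add] at h
  refine (add_left_cancel h).trans ?_
  rw [subst_sum, Finset.mul_sum]
  refine Finset.sum_congr rfl fun i _ => ?_
  rw [subst_smul, subst_chg_X, chg, mul_smul_comm]

theorem eta_singleton (φ : NCFunctional d) (i : Fin d) :
    φ.eta [i] = φ (FreeAlgebra.ι ℂ i) := by
  have h := congrFun (congrArg (D i) φ.one_sub_eta_mul) []
  rw [D_mul, D_sub, D_add, D_one, zero_add, zero_sub, NCSeries.add_apply, mul_nil,
    NCSeries.smul_apply, NCSeries.neg_apply, NCSeries.sub_apply, NCSeries.add_apply, one_nil,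
    eta_nil, M_nil, sub_zero, add_zero, one_mul, mul_one, NCSeries.zero_apply, D_apply,
    D_apply, neg_add_eq_zero] at h
  rw [h]
  simp [M, monomial]

theorem R_singleton (φ : NCFunctional d) (i : Fin d) : φ.R [i] = φ (FreeAlgebra.ι ℂ i) := by
  have h := subst_chg_nil φ.M (D i φ.R)
  rw [← D_eta, D_apply, D_apply] at h
  rw [← h, eta_singleton]

/-- The second derivatives of the Boolean cumulants of `Φ[φ, ψ]`. -/
theorem D_D_inverse_mul_subst {φ : NCFunctional d} (hφ : ∀ i, φ (FreeAlgebra.ι ℂ i) = 0)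
    (ψ : NCFunctional d) {h : NCSeries d}
    (hh : h = Ring.inverse (1 + ψ.M) * subst φ.R (chg ψ.M)) (i j : Fin d) :
    D i (D j h) = subst (D i (D j φ.R)) (chg ψ.M) + D i ψ.eta * D j h := by
  have h1 : D j h = subst (D j φ.R) (chg ψ.M) := by
    rw [hh, D_inverse_mul_subst ψ.M_nil φ.R_nil]
  -- Zero means make the constant term of `D j φ.R` vanish, which permits a second application; the
  -- left side is then `D i ((1 - ψ.eta) * D j h)`.
  have h2 := D_inverse_mul_subst ψ.M_nil (R := D j φ.R)
    (by rw [D_apply, R_singleton, hφ]) i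
  rw [← h1, ← one_sub_eta, D_mul, D_sub, D_one, zero_sub, NCSeries.sub_apply, one_nil, eta_nil,
    sub_zero, one_smul, neg_mul] at h2
  rw [← h2]
  abel

theorem subst_quadratic (M : NCSeries d) (R : NCSeries d) (i j : Fin d) (t : Fin d → ℂ)
    (c : ℂ) :
    subst ((if i = j then 1 else 0) + ∑ k, t k • D k R + c • (D i R * D j R)) (chg M) =
      (if i = j then 1 else 0) + ∑ k, t k • subst (D k R) (chg M) +
        c • (subst (D i R) (chg M) * subst (D j R) (chg M)) := by
  rw [subst_add, subst_add, subst_sum, subst_smul, subst_chg_mul]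
  simp only [subst_smul]
  congr 2
  split_ifs
  · exact subst_chg_one M
  · exact subst_zero _

/-- For a functional with zero means, the quadratic equation of the free cumulants is equivalent
to the one of the Boolean cumulants. -/
theorem isBooleanMeixner_eta_iff {φ : NCFunctional d} (hφ : ∀ i, φ (FreeAlgebra.ι ℂ i) = 0)
    (T : Fin d → Matrix (Fin d) (Fin d) ℂ) (C : Matrix (Fin d) (Fin d) ℝ) :
    IsBooleanMeixner T C φ.eta ↔
      ∀ i j, D i (D j φ.R) = (if i = j then 1 else 0) + ∑ k, T i j k • D k φ.R
        + (C i j : ℂ) • (D i φ.R * D j φ.R) := by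
  have h1 := D_D_inverse_mul_subst hφ φ φ.eta_eq_inverse_mul_subst
  -- The extra product of first derivatives is what raises the coefficient `C i j` to `1 + C i j`.
  have h2 : ∀ i j, subst ((if i = j then 1 else 0) + ∑ k, T i j k • D k φ.R
        + (C i j : ℂ) • (D i φ.R * D j φ.R)) (chg φ.M) + D i φ.eta * D j φ.eta =
      (if i = j then 1 else 0) + ∑ k, T i j k • D k φ.eta
        + ((1 + C i j : ℝ) : ℂ) • (D i φ.eta * D j φ.eta) := by
    intro i j
    rw [subst_quadratic]
    simp only [← D_eta]
    push_cast
    rw [add_smul, one_smul]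
    abel
  constructor
  · intro h i j
    refine subst_chg_injective φ.M_nil (add_right_cancel (b := D i φ.eta * D j φ.eta) ?_)
    rw [h2, ← h1, h.quadratic]
  · intro h
    refine ⟨φ.eta_nil, fun i => by rw [eta_singleton, hφ], fun i j => ?_⟩
    rw [h1, h, h2]

/-! ### The transformations `Φ` and `B` -/

theorem R_boxpow_boxplus_delta (φ : NCFunctional d) (s : ℝ) (a : Fin d → ℝ) :
    ((φ.boxpow s).boxplus (delta a)).R = (s : ℂ) • φ.R + ∑ i, (a i : ℂ) • X i := by
  have h : ((s : ℂ) • φ.R) [] = 0 := by rw [NCSeries.smul_apply, R_nil, mul_zero]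
  rw [boxplus, R_ofR, boxpow, R_ofR h, R_delta]
  rw [NCSeries.add_apply, R_nil, R_nil, add_zero]

theorem inverse_mul_subst_nil (φ ψ : NCFunctional d) :
    (Ring.inverse (1 + ψ.M) * subst φ.R (chg ψ.M)) [] = 0 := by
  rw [mul_nil, subst_chg_nil, R_nil, mul_zero]

theorem eta_Phi (φ ψ : NCFunctional d) :
    (Phi φ ψ).eta = Ring.inverse (1 + ψ.M) * subst φ.R (chg ψ.M) := by
  rw [Phi, eta_ofEta (inverse_mul_subst_nil φ ψ)]

theorem D_eta_Phi (φ ψ : NCFunctional d) (i : Fin d) :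
    D i (Phi φ ψ).eta = subst (D i φ.R) (chg ψ.M) := by
  rw [eta_Phi, D_inverse_mul_subst ψ.M_nil φ.R_nil]

/-- Derivatives of both sides are substitutions into the same `chg ψ.M`, and `R^ψ = s R^φ + ∑ a_i
z_i` is affine in `R^φ`. -/
theorem eta_boxpow_boxplus_delta (φ : NCFunctional d) (s : ℝ) (a : Fin d → ℝ) :
    ((φ.boxpow s).boxplus (delta a)).eta =
      (s : ℂ) • (Phi φ ((φ.boxpow s).boxplus (delta a))).eta + ∑ i, (a i : ℂ) • X i := by
  apply ext_D
  · rw [NCSeries.add_apply, NCSeries.smul_apply, eta_nil, eta_nil, sum_smul_X_nil]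
    ring
  · intro i
    rw [D_add, D_smul, D_eta_Phi, D_eta, R_boxpow_boxplus_delta, D_add, D_smul, D_sum_smul_X,
      subst_add, subst_smul, subst_smul, subst_chg_one]

/-- In `eta_boxpow_boxplus_delta` the Boolean convolution with `δ_{-a}` cancels the linear term and
the Boolean power cancels `1 + t`; only this last division needs `t ≠ -1`. -/
theorem BT_eq_Phi (φ : NCFunctional d) (a : Fin d → ℝ) {t : ℝ} (ht : t ≠ -1) :
    BT a t φ = Phi φ ((φ.boxpow (1 + t)).boxplus (delta a)) := by
  have ht' : 1 + t ≠ 0 := fun h => ht (by linarith)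
  refine ext_eta (ofEta_one _) (ofEta_one _) ?_
  have h0 : ∀ (c : ℂ) (ψ : NCFunctional d), (c • ψ.eta) [] = 0 := fun c ψ => by
    rw [NCSeries.smul_apply, eta_nil, mul_zero]
  rw [BT, upow, eta_ofEta (h0 _ _), uplus, eta_ofEta, eta_delta, eta_boxpow_boxplus_delta]
  · have : ∑ i, (((-a) i : ℝ) : ℂ) • (X i : NCSeries d) = -∑ i, (a i : ℂ) • X i := by
      rw [← Finset.sum_neg_distrib]
      exact Finset.sum_congr rfl fun i _ => by simp
    rw [this, add_neg_cancel_right, smul_smul, ← Complex.ofReal_mul, one_div_mul_cancel ht',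
      Complex.ofReal_one, one_smul]
  · rw [NCSeries.add_apply, eta_nil, eta_nil, add_zero]

/-- In the product `D_i η^ψ · D_j η^Φ` the factor `D_i η^ψ` is `(1 + t) D_i η^Φ + a_i`: its first
summand shifts `C` by `t` (and supplies the Boolean `1`), its second shifts `T_i` by `a_i I`. -/
theorem isBooleanMeixner_eta_Phi {φ : NCFunctional d} (hφ : ∀ i, φ (FreeAlgebra.ι ℂ i) = 0)
    {T : Fin d → Matrix (Fin d) (Fin d) ℂ} {C : Matrix (Fin d) (Fin d) ℝ}
    (h : IsBooleanMeixner T C φ.eta) (a : Fin d → ℝ) (t : ℝ) :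
    IsBooleanMeixner (fun i => (a i : ℂ) • (1 : Matrix (Fin d) (Fin d) ℂ) + T i)
      (Matrix.of fun i j => t + C i j)
      (Phi φ ((φ.boxpow (1 + t)).boxplus (delta a))).eta := by
  set ψ := (φ.boxpow (1 + t)).boxplus (delta a) with hψ
  refine ⟨eta_nil _, fun i => ?_, fun i j => ?_⟩
  · have := congrFun (D_eta_Phi φ ψ i) []
    rwa [subst_chg_nil, D_apply, D_apply, R_singleton, hφ] at this
  · rw [D_D_inverse_mul_subst hφ ψ (eta_Phi φ ψ), (isBooleanMeixner_eta_iff hφ T C).1 h,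
      subst_quadratic, eta_boxpow_boxplus_delta φ (1 + t) a]
    simp only [← D_eta_Phi, ← hψ]
    rw [D_add, D_smul, D_sum_smul_X, add_mul, smul_mul_assoc, smul_mul_assoc, one_mul]
    simp only [Matrix.add_apply, Matrix.smul_apply, Matrix.one_apply, Matrix.of_apply, add_smul,
      Finset.sum_add_distrib, smul_eq_mul, mul_ite, mul_one, mul_zero, ite_smul, zero_smul,
      Finset.sum_ite_eq, Finset.mem_univ, if_true, Complex.ofReal_add]
    abel

end NCFunctional

namespace NCFunctional

open NCSeries

variable {d : ℕ}

/-! ### The involution -/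

theorem monomial_induction {p : FreeAlgebra ℂ (Fin d) → Prop} (mono : ∀ u, p (monomial u))
    (add : ∀ P Q, p P → p Q → p (P + Q)) (smul : ∀ (c : ℂ) P, p P → p (c • P))
    (P : FreeAlgebra ℂ (Fin d)) : p P := by
  have hP : P ∈ Submodule.span ℂ (Set.range (FreeAlgebra.basisFreeMonoid ℂ (Fin d))) := by
    rw [Module.Basis.span_eq]; trivial
  induction hP using Submodule.span_induction with
  | mem x hx =>
    obtain ⟨u, rfl⟩ := hx
    rw [basis_eq_monomial]
    exact mono _
  | zero => simpa using smul 0 _ (mono [])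
  | add x y _ _ hx hy => exact add x y hx hy
  | smul c x _ hx => exact smul c x hx

theorem adj_add (P Q : FreeAlgebra ℂ (Fin d)) : adj (P + Q) = adj P + adj Q := by
  rw [adj, map_add, Finsupp.sum_add_index']
  · rfl
  · simp
  · intro u c c'
    rw [map_add, add_smul]

theorem adj_smul (c : ℂ) (P : FreeAlgebra ℂ (Fin d)) :
    adj (c • P) = starRingEnd ℂ c • adj P := by
  rw [adj, map_smul, Finsupp.sum_smul_index' (by simp), adj, Finsupp.smul_sum]
  simp only [smul_eq_mul, map_mul, mul_smul]

theorem adj_monomial (u : List (Fin d)) : adj (monomial u) = monomial u.reverse := by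
  have h := basis_eq_monomial (FreeMonoid.ofList u)
  rw [FreeMonoid.toList_ofList] at h
  rw [← h, adj, Module.Basis.repr_self, Finsupp.sum_single_index (by simp), map_one, one_smul,
    FreeMonoid.toList_ofList]

/-! ### The Fock space model -/

/-- The squared norm of `e_j ⊗ e_v` relative to that of `e_v`. -/
def stepWeight (C : Matrix (Fin d) (Fin d) ℝ) (j : Fin d) : List (Fin d) → ℝ
  | [] => 1
  | k :: _ => 1 + C j k

/-- The squared norm of the basis vector `e_v` of the Fock space. -/
def fockWeight (C : Matrix (Fin d) (Fin d) ℝ) : List (Fin d) → ℝ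
  | [] => 1
  | j :: v => stepWeight C j v * fockWeight C v

theorem fockWeight_nonneg {C : Matrix (Fin d) (Fin d) ℝ} (hC : ∀ i j, -1 ≤ C i j)
    (v : List (Fin d)) : 0 ≤ fockWeight C v := by
  induction v with
  | nil => exact zero_le_one
  | cons j v ih =>
    refine mul_nonneg ?_ ih
    cases v with
    | nil => exact zero_le_one
    | cons k v => simp only [stepWeight]; linarith [hC j k]

/-- The vector `X_i e_v` for a word `v`. -/
noncomputable def fockAct (T : Fin d → Matrix (Fin d) (Fin d) ℂ) (C : Matrix (Fin d) (Fin d) ℝ)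
    (i : Fin d) : List (Fin d) → (List (Fin d) →₀ ℂ)
  | [] => Finsupp.single [i] 1
  | j :: v => Finsupp.single (i :: j :: v) 1 + ∑ k, Finsupp.single (k :: v) (T i k j)
      + if i = j then Finsupp.single v (stepWeight C j v : ℂ) else 0

/-- The operator `X_i = a_i^+ + T_i + a_i^-` on the algebraic Fock space. -/
noncomputable def fockX (T : Fin d → Matrix (Fin d) (Fin d) ℂ) (C : Matrix (Fin d) (Fin d) ℝ)
    (i : Fin d) : Module.End ℂ (List (Fin d) →₀ ℂ) :=
  Finsupp.linearCombination ℂ (fockAct T C i)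

/-- The representation of `ℂ⟨x_1, …, x_d⟩` by `x_i ↦ X_i`. -/
noncomputable def fockRep (T : Fin d → Matrix (Fin d) (Fin d) ℂ) (C : Matrix (Fin d) (Fin d) ℝ) :
    FreeAlgebra ℂ (Fin d) →ₐ[ℂ] Module.End ℂ (List (Fin d) →₀ ℂ) :=
  FreeAlgebra.lift ℂ (fockX T C)

section Fock

variable (T : Fin d → Matrix (Fin d) (Fin d) ℂ) (C : Matrix (Fin d) (Fin d) ℝ)

theorem fockX_single (i : Fin d) (v : List (Fin d)) :
    fockX T C i (Finsupp.single v 1) = fockAct T C i v := by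
  rw [fockX, Finsupp.linearCombination_single, one_smul]

theorem fockX_apply_nil (i : Fin d) (f : List (Fin d) →₀ ℂ) : fockX T C i f [] = f [i] := by
  induction f using Finsupp.induction_linear with
  | zero => simp
  | add f g hf hg => rw [map_add, Finsupp.add_apply, Finsupp.add_apply, hf, hg]
  | single u c =>
    rw [fockX, Finsupp.linearCombination_single, Finsupp.smul_apply]
    cases u with
    | nil => simp [fockAct]
    | cons j v =>
      by_cases hij : i = j
      · subst hij
        cases v <;> simp [fockAct, stepWeight]
      · simp [fockAct, hij]

/-- A row of the matrix of `X_i`: its three terms match those of the Boolean quadratic equation one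
by one, which is why the model has the right moments. -/
theorem fockX_apply_cons (i j : Fin d) (v : List (Fin d)) (f : List (Fin d) →₀ ℂ) :
    fockX T C i f (j :: v) = (if i = j then f v else 0) + ∑ k, T i j k * f (k :: v)
      + ((1 + C i j : ℝ) : ℂ) * f (i :: j :: v) := by
  induction f using Finsupp.induction_linear with
  | zero => simp
  | add f g hf hg =>
    rw [map_add, Finsupp.add_apply, hf, hg]
    simp only [Finsupp.add_apply, mul_add, Finset.sum_add_distrib]
    split_ifs <;> ring
  | single u c =>
    rw [fockX, Finsupp.linearCombination_single, Finsupp.smul_apply]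
    rcases u with _ | ⟨l, u⟩
    · rcases v with _ | ⟨m, v⟩ <;> simp [fockAct, Finsupp.single_apply]
    · have h1 : (∑ k, Finsupp.single (k :: u) (T i k l) : List (Fin d) →₀ ℂ) (j :: v) =
          if u = v then T i j l else 0 := by
        by_cases huv : u = v <;>
          simp [Finsupp.finsetSum_apply, Finsupp.single_apply, huv]
      have h2 : ∑ k, T i j k * (Finsupp.single (l :: u) c : List (Fin d) →₀ ℂ) (k :: v) =
          if u = v then T i j l * c else 0 := by
        by_cases huv : u = v <;> simp [Finsupp.single_apply, huv]
      have h3 : (if i = l then Finsupp.single u (stepWeight C l u : ℂ) else 0 :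
          List (Fin d) →₀ ℂ) (j :: v) =
          if i = l ∧ u = j :: v then ((1 + C i j : ℝ) : ℂ) else 0 := by
        by_cases hil : i = l
        · by_cases hu : u = j :: v
          · simp [hil, hu, stepWeight]
          · simp [hil, hu]
        · simp [hil]
      rw [fockAct, Finsupp.add_apply, Finsupp.add_apply, h1, h2, h3]
      have h4 : (Finsupp.single (i :: l :: u) 1 : List (Fin d) →₀ ℂ) (j :: v) =
          if i = j ∧ l :: u = v then 1 else 0 := by
        simp [Finsupp.single_apply]
      have h5 : (Finsupp.single (l :: u) c : List (Fin d) →₀ ℂ) (i :: j :: v) =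
          if i = l ∧ u = j :: v then c else 0 := by
        simp [Finsupp.single_apply, eq_comm]
      rw [h4, h5, Finsupp.single_apply, smul_eq_mul, ite_and]
      split_ifs <;> ring

theorem fockRep_monomial_cons (i : Fin d) (s : List (Fin d)) (f : List (Fin d) →₀ ℂ) :
    fockRep T C (monomial (i :: s)) f = fockX T C i (fockRep T C (monomial s) f) := by
  simp [monomial, fockRep]

/-- The coefficients of `X_s Ω`, as series in `s`, in terms of the Boolean cumulants. -/
theorem fockRep_monomial_apply {φ : NCFunctional d} (h : IsBooleanMeixner T C φ.eta)
    (s v : List (Fin d)) :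
    fockRep T C (monomial s) (Finsupp.single [] 1) v =
      ((v.map fun j => D j φ.eta).prod * (1 + φ.M) : NCSeries d) s := by
  have hD : ∀ j, D j φ.eta [] = 0 := h.singleton
  have h0 : ∀ (j : Fin d) (F : NCSeries d), (D j φ.eta * F) [] = 0 := fun j F => by
    rw [mul_nil, hD, zero_mul]
  induction s generalizing v with
  | nil =>
    rw [monomial_nil, map_one, Module.End.one_apply]
    cases v with
    | nil => simp [NCSeries.add_apply, one_nil, M_nil]
    | cons j v => rw [List.map_cons, List.prod_cons, mul_assoc, h0]; simp
  | cons i s ih =>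
    rw [fockRep_monomial_cons]
    cases v with
    | nil =>
      rw [fockX_apply_nil, ih]
      -- The vacuum row is `D_i M = D_i η · (1 + M)`, the derivative of `(1 - η)(1 + M) = 1`.
      have := congrFun (congrArg (D i) φ.one_sub_eta_mul) s
      rw [D_mul, D_sub, D_one, zero_sub, NCSeries.sub_apply, one_nil, eta_nil, sub_zero,
        one_smul, NCSeries.zero_apply, NCSeries.add_apply, neg_mul, NCSeries.neg_apply,
        neg_add_eq_zero, D_apply] at this
      simpa only [List.map_cons, List.map_nil, List.prod_cons, List.prod_nil, mul_one, one_mul]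
        using this
    | cons j v =>
      rw [fockX_apply_cons]
      simp only [ih, List.map_cons, List.prod_cons, mul_assoc]
      generalize (List.map (fun j => D j φ.eta) v).prod * (1 + φ.M) = G
      -- Since `D j φ.eta` has no constant term, the Leibniz rule leaves only `D i (D j φ.eta) * G`,
      -- to which the quadratic equation applies.
      change _ = D i (D j φ.eta * G) s
      rw [D_mul, hD, zero_smul, add_zero, h.quadratic, add_mul, add_mul, Finset.sum_mul,
        NCSeries.add_apply, NCSeries.add_apply, NCSeries.sum_apply, smul_mul_assoc,
        NCSeries.smul_apply, mul_assoc]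
      simp only [smul_mul_assoc, NCSeries.smul_apply]
      congr 2
      split_ifs <;> simp [NCSeries.zero_apply]

theorem apply_eq_fockRep {φ : NCFunctional d} (hφ : φ 1 = 1) (h : IsBooleanMeixner T C φ.eta)
    (P : FreeAlgebra ℂ (Fin d)) : φ P = fockRep T C P (Finsupp.single [] 1) [] := by
  induction P using monomial_induction with
  | mono u =>
    rw [fockRep_monomial_apply T C h, List.map_nil, List.prod_nil, one_mul, NCSeries.add_apply,
      one_apply, M]
    split_ifs with hu
    · rw [hu, monomial_nil, hφ, add_zero]
    · rw [zero_add]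
  | add P Q hP hQ =>
    rw [map_add, map_add, LinearMap.add_apply, Finsupp.add_apply, hP, hQ]
  | smul c P hP =>
    rw [map_smul, map_smul, LinearMap.smul_apply, Finsupp.smul_apply, hP]

/-- The weighted inner product of the Fock space. -/
noncomputable def fockInner (f g : List (Fin d) →₀ ℂ) : ℂ :=
  f.sum fun u c => starRingEnd ℂ c * ((fockWeight C u : ℂ) * g u)

theorem fockInner_add_left (f f' g : List (Fin d) →₀ ℂ) :
    fockInner C (f + f') g = fockInner C f g + fockInner C f' g := by
  rw [fockInner, Finsupp.sum_add_index']
  · rfl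
  · simp
  · intro u c c'
    rw [map_add, add_mul]

theorem fockInner_smul_left (c : ℂ) (f g : List (Fin d) →₀ ℂ) :
    fockInner C (c • f) g = starRingEnd ℂ c * fockInner C f g := by
  rw [fockInner, Finsupp.sum_smul_index' (by simp), fockInner, Finsupp.mul_sum]
  simp only [smul_eq_mul, map_mul, mul_assoc]

theorem fockInner_add_right (f g g' : List (Fin d) →₀ ℂ) :
    fockInner C f (g + g') = fockInner C f g + fockInner C f g' := by
  rw [fockInner, fockInner, fockInner, ← Finsupp.sum_add]
  simp only [Finsupp.add_apply, mul_add]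

theorem fockInner_smul_right (c : ℂ) (f g : List (Fin d) →₀ ℂ) :
    fockInner C f (c • g) = c * fockInner C f g := by
  rw [fockInner, fockInner, Finsupp.mul_sum]
  refine Finsupp.sum_congr fun u _ => ?_
  rw [Finsupp.smul_apply, smul_eq_mul]
  ring

theorem fockInner_single_left (u : List (Fin d)) (c : ℂ) (g : List (Fin d) →₀ ℂ) :
    fockInner C (Finsupp.single u c) g = starRingEnd ℂ c * ((fockWeight C u : ℂ) * g u) := by
  rw [fockInner, Finsupp.sum_single_index (by simp)]

theorem fockInner_single_right (f : List (Fin d) →₀ ℂ) (v : List (Fin d)) (c : ℂ) :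
    fockInner C f (Finsupp.single v c) = starRingEnd ℂ (f v) * ((fockWeight C v : ℂ) * c) := by
  induction f using Finsupp.induction_linear with
  | zero => simp [fockInner]
  | add f g hf hg => rw [fockInner_add_left, hf, hg, Finsupp.add_apply, map_add, add_mul]
  | single u a =>
    rw [fockInner_single_left]
    by_cases h : u = v
    · subst h; simp
    · simp [h, Ne.symm h]

theorem fockInner_self_re_nonneg (hC : ∀ i j, -1 ≤ C i j) (f : List (Fin d) →₀ ℂ) :
    0 ≤ (fockInner C f f).re := by
  rw [fockInner, Finsupp.sum, Complex.re_sum]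
  refine Finset.sum_nonneg fun u _ => ?_
  have : starRingEnd ℂ (f u) * ((fockWeight C u : ℂ) * f u) =
      ((fockWeight C u * Complex.normSq (f u) : ℝ) : ℂ) := by
    rw [Complex.ofReal_mul, Complex.normSq_eq_conj_mul_self]; ring
  rw [this, Complex.ofReal_re]
  exact mul_nonneg (fockWeight_nonneg hC u) (Complex.normSq_nonneg _)

variable {T C}

/-- The weights are chosen so that creation and annihilation are mutually adjoint. `T_i` is
Hermitian, and commuting with `C` it respects the weights. -/
theorem fockInner_fockX (hT : ∀ i, (T i).IsHermitian)
    (hTC : ∀ i j k l, T i j l * C l k = C j k * T i j l) (i : Fin d)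
    (f g : List (Fin d) →₀ ℂ) :
    fockInner C (fockX T C i f) g = fockInner C f (fockX T C i g) := by
  have hstar : ∀ j k, starRingEnd ℂ (T i j k) = T i k j := fun j k => (hT i).apply k j
  have basis : ∀ u v, fockInner C (fockX T C i (Finsupp.single u 1)) (Finsupp.single v 1) =
      fockInner C (Finsupp.single u 1) (fockX T C i (Finsupp.single v 1)) := by
    intro u v
    rw [fockInner_single_left, fockInner_single_right, map_one, one_mul, mul_one]
    rcases u with _ | ⟨l, u⟩ <;> rcases v with _ | ⟨j, v⟩
    · simp [fockX_apply_nil]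
    · rw [fockX_apply_nil, fockX_apply_cons]
      by_cases hij : i = j
      · cases v <;> simp [hij, fockWeight, stepWeight]
      · cases v <;> simp [hij]
    · rw [fockX_apply_nil, fockX_apply_cons]
      by_cases hij : i = l
      · cases u <;> simp [hij, fockWeight, stepWeight]
      · cases u <;> simp [hij]
    · have hsum : ∀ (j l : Fin d) (u v : List (Fin d)),
          ∑ k, T i j k * (Finsupp.single (l :: u) 1 : List (Fin d) →₀ ℂ) (k :: v) =
          if u = v then T i j l else 0 := by
        intro j l u v
        by_cases huv : u = v <;> simp [Finsupp.single_apply, huv]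
      rw [fockX_apply_cons, fockX_apply_cons, hsum, hsum]
      -- Creation on the left against annihilation on the right; `e3` is the mirror case and `e2`
      -- the term with `T_i`.
      have e1 : (starRingEnd ℂ (if i = j then
            (Finsupp.single (l :: u) 1 : List (Fin d) →₀ ℂ) v else 0)) * fockWeight C (j :: v) =
          fockWeight C (l :: u) * (((1 + C i l : ℝ) : ℂ) *
            (Finsupp.single (j :: v) 1 : List (Fin d) →₀ ℂ) (i :: l :: u)) := by
        by_cases hij : i = j
        · subst hij
          by_cases hv : l :: u = v
          · subst hv
            simp [fockWeight, stepWeight]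
            ring
          · simp [hv, Ne.symm hv]
        · simp [hij]
      have e3 : starRingEnd ℂ (((1 + C i j : ℝ) : ℂ) *
            (Finsupp.single (l :: u) 1 : List (Fin d) →₀ ℂ) (i :: j :: v)) *
            fockWeight C (j :: v) =
          fockWeight C (l :: u) * (if i = l then
            (Finsupp.single (j :: v) 1 : List (Fin d) →₀ ℂ) u else 0) := by
        by_cases hil : i = l
        · subst hil
          by_cases hu : j :: v = u
          · subst hu
            simp [fockWeight, stepWeight]
          · simp [hu, Ne.symm hu]
        · simp [hil]
      have e2 : starRingEnd ℂ (if u = v then T i j l else 0) * fockWeight C (j :: v) =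
          fockWeight C (l :: u) * if v = u then T i l j else 0 := by
        by_cases huv : u = v
        · subst huv
          simp only [if_true, hstar, fockWeight, Complex.ofReal_mul]
          have : T i l j * stepWeight C j u = stepWeight C l u * T i l j := by
            cases u with
            | nil => simp [stepWeight]
            | cons k u =>
              simp only [stepWeight, Complex.ofReal_add, Complex.ofReal_one]
              linear_combination hTC i l k j
          linear_combination (fockWeight C u : ℂ) * this
        · simp [huv, Ne.symm huv]
      rw [map_add, map_add, add_mul, add_mul, e1, e2, e3]
      ring
  induction f using Finsupp.induction_linear with
  | zero => simp [fockInner]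
  | add f f' hf hf' => rw [map_add, fockInner_add_left, fockInner_add_left, hf, hf']
  | single u a =>
    induction g using Finsupp.induction_linear with
    | zero => simp [fockInner]
    | add g g' hg hg' => rw [map_add, fockInner_add_right, fockInner_add_right, hg, hg']
    | single v b =>
      rw [← mul_one a, ← mul_one b, ← smul_eq_mul, ← smul_eq_mul, ← Finsupp.smul_single,
        ← Finsupp.smul_single, map_smul, map_smul, fockInner_smul_left, fockInner_smul_left,
        fockInner_smul_right, fockInner_smul_right, basis]

theorem fockInner_fockRep_adj (hT : ∀ i, (T i).IsHermitian)
    (hTC : ∀ i j k l, T i j l * C l k = C j k * T i j l) (P : FreeAlgebra ℂ (Fin d))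
    (f g : List (Fin d) →₀ ℂ) :
    fockInner C (fockRep T C (adj P) f) g = fockInner C f (fockRep T C P g) := by
  induction P using monomial_induction with
  | mono u =>
    rw [adj_monomial]
    induction u generalizing f with
    | nil => simp [monomial_nil]
    | cons i u ih =>
      rw [List.reverse_cons, monomial_append, map_mul, Module.End.mul_apply, ih,
        fockRep_monomial_cons, fockRep_monomial_cons, monomial_nil, map_one,
        Module.End.one_apply, fockInner_fockX hT hTC]
  | add P Q hP hQ =>
    rw [adj_add, map_add, map_add, LinearMap.add_apply, LinearMap.add_apply, fockInner_add_left,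
      fockInner_add_right, hP, hQ]
  | smul c P hP =>
    rw [adj_smul, map_smul, map_smul, LinearMap.smul_apply, LinearMap.smul_apply,
      fockInner_smul_left, fockInner_smul_right, hP, Complex.conj_conj]

/-- The functional with the Boolean cumulants of a free Meixner state is a state. -/
theorem isState_of_isBooleanMeixner (hT : ∀ i, (T i).IsHermitian)
    (hTC : ∀ i j k l, T i j l * C l k = C j k * T i j l) (hC : ∀ i j, -1 ≤ C i j)
    {φ : NCFunctional d} (hφ : φ 1 = 1) (h : IsBooleanMeixner T C φ.eta) : IsState φ := by
  have hadj : ∀ P f, fockRep T C (adj P) f [] =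
      starRingEnd ℂ (fockInner C f (fockRep T C P (Finsupp.single [] 1))) := by
    intro P f
    rw [← fockInner_fockRep_adj hT hTC, fockInner_single_right]
    simp [fockWeight]
  refine ⟨hφ, fun P => ?_, fun P => ?_⟩
  · rw [apply_eq_fockRep T C hφ h, apply_eq_fockRep T C hφ h, hadj, fockInner_single_left]
    simp [fockWeight]
  · rw [apply_eq_fockRep T C hφ h, map_mul, Module.End.mul_apply, hadj, Complex.conj_re]
    exact fockInner_self_re_nonneg C hC _

theorem isFreeMeixnerState_iff {φ : NCFunctional d} :
    IsFreeMeixnerState T C φ ↔ IsState φ ∧ IsBooleanMeixner T C φ.eta := by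
  constructor
  · intro h
    exact ⟨h.isState, (isBooleanMeixner_eta_iff h.mean_zero T C).2 h.quadratic⟩
  · rintro ⟨h1, h2⟩
    have h0 : ∀ i, φ (FreeAlgebra.ι ℂ i) = 0 := fun i => by
      rw [← eta_singleton, h2.singleton]
    exact ⟨h1, h0, (isBooleanMeixner_eta_iff h0 T C).1 h2⟩

theorem existsUnique_isFreeMeixnerState (hT : ∀ i, (T i).IsHermitian)
    (hTC : ∀ i j k l, T i j l * C l k = C j k * T i j l) (hC : ∀ i j, -1 ≤ C i j) :
    ∃! φ, IsFreeMeixnerState T C φ := by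
  obtain ⟨h, hh, huniq⟩ := existsUnique_isBooleanMeixner T C
  refine ⟨ofEta h, ?_, fun ψ hψ => ?_⟩
  · rw [← eta_ofEta hh.nil] at hh
    exact isFreeMeixnerState_iff.2
      ⟨isState_of_isBooleanMeixner hT hTC hC (ofEta_one h) hh, hh⟩
  · obtain ⟨h1, h2⟩ := isFreeMeixnerState_iff.1 hψ
    exact ext_eta h1.unital (ofEta_one h) (by rw [eta_ofEta hh.nil, huniq _ h2])

end Fock

end NCFunctional

/-! ### Conditions on `T` and `C` forced by symmetry of the cumulants -/

namespace NCSeries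

variable {d : ℕ}

/-- The involution of series with `z_i^* = z_i`. -/
noncomputable def conj (f : NCSeries d) : NCSeries d := fun w => starRingEnd ℂ (f w.reverse)

theorem conj_mul (f g : NCSeries d) : conj (f * g) = conj g * conj f := by
  ext w
  simp only [conj, mul_apply, map_sum, map_mul, List.length_reverse]
  rw [← Finset.sum_range_reflect]
  refine Finset.sum_congr rfl fun i hi => ?_
  have hi' : i ≤ w.length := by simpa [Nat.lt_succ_iff] using hi
  rw [List.take_reverse, List.drop_reverse, mul_comm,
    show w.length - (w.length + 1 - 1 - i) = i by omega]

theorem conj_one : conj (1 : NCSeries d) = 1 := by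
  ext w
  by_cases h : w = [] <;> simp [conj, one_apply, h]

theorem mul_pair {f g : NCSeries d} (hf : f [] = 0) (hg : g [] = 0) (a b : Fin d) :
    (f * g) [a, b] = f [a] * g [b] := by
  simp [mul_apply, Finset.sum_range_succ, hf, hg]

theorem mul_triple {f g : NCSeries d} (hf : f [] = 0) (hg : g [] = 0) (a b c : Fin d) :
    (f * g) [a, b, c] = f [a] * g [b, c] + f [a, b] * g [c] := by
  simp [mul_apply, Finset.sum_range_succ, hf, hg]

namespace IsBooleanMeixner

variable {T : Fin d → Matrix (Fin d) (Fin d) ℂ} {C : Matrix (Fin d) (Fin d) ℝ} {h : NCSeries d}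

theorem apply_cons_cons (H : IsBooleanMeixner T C h) (i j : Fin d) (v : List (Fin d)) :
    h (j :: i :: v) = (if i = j then (1 : NCSeries d) v else 0) + ∑ k, T i j k * h (k :: v)
      + ((1 + C i j : ℝ) : ℂ) * (D i h * D j h) v := by
  have := congrFun (H.quadratic i j) v
  rw [D_apply, D_apply, add_apply, add_apply, smul_apply, sum_apply] at this
  rw [this]
  congr 2
  split_ifs <;> rfl

theorem apply_pair (H : IsBooleanMeixner T C h) (i j : Fin d) :
    h [j, i] = if i = j then 1 else 0 := by
  rw [H.apply_cons_cons, mul_nil, D_apply]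
  simp [H.singleton, one_nil]

theorem apply_triple (H : IsBooleanMeixner T C h) (i j l : Fin d) : h [j, i, l] = T i j l := by
  have h0 : (D i h * D j h) [l] = 0 := by
    simp [mul_apply, Finset.sum_range_succ, D_apply, H.singleton]
  rw [H.apply_cons_cons, h0]
  simp [H.apply_pair, one_apply]

theorem apply_four (H : IsBooleanMeixner T C h) (i j l m : Fin d) :
    h [j, i, l, m] = ∑ k, T i j k * T l k m +
      if i = l ∧ j = m then ((1 + C i j : ℝ) : ℂ) else 0 := by
  rw [H.apply_cons_cons, mul_pair (H.singleton i) (H.singleton j), D_apply, D_apply,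
    H.apply_pair, H.apply_pair]
  simp only [H.apply_triple, eq_comm (a := l) (b := i), eq_comm (a := m) (b := j)]
  by_cases h1 : i = l <;> by_cases h2 : j = m <;>
    simp [h1, h2, one_apply]

/-- Order five is where products of entries of `C` and `T` first appear. The equal outer letters
make the factor `h [j, j]` equal to `1`, so that such a product survives. -/
theorem apply_five (H : IsBooleanMeixner T C h) (i j l m : Fin d) :
    h [j, i, l, m, j] = ∑ k, T i j k * ∑ p, T l k p * T m p j
      + (if l = m then ((1 + C l j : ℝ) : ℂ) * T i j j else 0)
      + (if i = l then ((1 + C l j : ℝ) : ℂ) * T m j j else 0)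
      + ((1 + C i j : ℝ) : ℂ) * T l i m := by
  rw [H.apply_cons_cons, mul_triple (H.singleton i) (H.singleton j), D_apply, D_apply, D_apply,
    D_apply, H.apply_pair, H.apply_pair, H.apply_triple, H.apply_triple]
  have h1 : ∑ k, T i j k * h [k, l, m, j] = ∑ k, T i j k * ∑ p, T l k p * T m p j
      + if l = m then ((1 + C l j : ℝ) : ℂ) * T i j j else 0 := by
    simp only [H.apply_four, mul_add, Finset.sum_add_distrib]
    congr 1
    by_cases hlm : l = m <;> simp [hlm, mul_comm]
  rw [h1]
  by_cases hil : i = l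
  · subst hil
    simp [one_apply]
    ring
  · simp [hil, Ne.symm hil, one_apply]

theorem isHermitian (H : IsBooleanMeixner T C h) (hh : conj h = h) (i : Fin d) :
    (T i).IsHermitian := by
  ext j k
  rw [Matrix.conjTranspose_apply, ← H.apply_triple, ← H.apply_triple]
  exact congrFun hh [j, i, k]

/-- The word `k j i l k` is compared with its reverse. By Hermiticity the cubic sums agree and the
two delta terms trade places, leaving `(1 + C l k) T i j l = (1 + C j k) T i j l`. -/
theorem mul_comm_of_conj (H : IsBooleanMeixner T C h) (hh : conj h = h) (i j k l : Fin d) :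
    T i j l * C l k = C j k * T i j l := by
  have hstar : ∀ i j k, starRingEnd ℂ (T i j k) = T i k j :=
    fun i j k => (H.isHermitian hh i).apply k j
  have h1 : starRingEnd ℂ (h [k, l, i, j, k]) = h [k, j, i, l, k] := congrFun hh [k, j, i, l, k]
  rw [H.apply_five, H.apply_five] at h1
  simp only [map_add, map_sum, map_mul, apply_ite (starRingEnd ℂ), map_zero,
    Complex.conj_ofReal, hstar] at h1
  have h2 : ∑ x, T l x k * ∑ y, T i y x * T j k y = ∑ x, T j k x * ∑ y, T i x y * T l y k := by
    simp only [Finset.mul_sum]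
    rw [Finset.sum_comm]
    exact Finset.sum_congr rfl fun x _ => Finset.sum_congr rfl fun y _ => by ring
  rw [h2] at h1
  simp only [eq_comm (a := l) (b := i), eq_comm (a := i) (b := j)] at h1
  push_cast at h1
  linear_combination h1

end IsBooleanMeixner

end NCSeries

/-! ### Free Meixner states are preserved -/

namespace NCFunctional

open NCSeries

variable {d : ℕ}

/-- `*`-compatibility is invariance of the moment series under `conj`, an anti-automorphism, so the
invariance passes to its inverse. -/
theorem conj_eta {φ : NCFunctional d} (hφ : IsState φ) : conj φ.eta = φ.eta := by
  have hM : conj (1 + φ.M) = 1 + φ.M := by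
    ext u
    rw [conj, NCSeries.add_apply, NCSeries.add_apply, one_apply, one_apply, M]
    by_cases hu : u = []
    · simp [hu, M_nil]
    · simp [hu, M, ← adj_monomial, hφ.star_compat]
  have h := congrArg conj φ.one_add_M_mul
  rw [conj_mul, conj_one, hM] at h
  have h1 := left_inv_eq_right_inv h φ.one_add_M_mul
  have h2 : conj (1 - φ.eta) = 1 - conj φ.eta := by
    ext u
    have := congrFun (conj_one (d := d)) u
    rw [conj] at this
    rw [conj, NCSeries.sub_apply, NCSeries.sub_apply, map_sub, this, conj]
  rw [h2] at h1
  exact sub_right_injective h1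

/-- Hermiticity and commutation are extracted from `φ` being a state. Adding `a_i I` to `T_i` and a
constant to all entries of `C` preserves both, and the Fock space with the new parameters gives
positivity. -/
theorem isFreeMeixnerState_Phi {T : Fin d → Matrix (Fin d) (Fin d) ℂ}
    {C : Matrix (Fin d) (Fin d) ℝ} {a : Fin d → ℝ} {t : ℝ} (hC : ∀ i j, -1 ≤ t + C i j)
    {φ : NCFunctional d} (hφ : IsFreeMeixnerState T C φ) :
    IsFreeMeixnerState (fun i => (a i : ℂ) • (1 : Matrix (Fin d) (Fin d) ℂ) + T i)
      (Matrix.of fun i j => t + C i j) (Phi φ ((φ.boxpow (1 + t)).boxplus (delta a))) := by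
  obtain ⟨h1, h2⟩ := isFreeMeixnerState_iff.1 hφ
  have h3 := isBooleanMeixner_eta_Phi hφ.mean_zero h2 a t
  have hconj := conj_eta h1
  refine isFreeMeixnerState_iff.2
    ⟨isState_of_isBooleanMeixner (fun i => ?_) (fun i j k l => ?_) hC (ofEta_one _) h3, h3⟩
  · refine Matrix.IsHermitian.add ?_ (h2.isHermitian hconj i)
    rw [Matrix.IsHermitian, Matrix.conjTranspose_smul, Matrix.conjTranspose_one]
    simp
  · have := h2.mul_comm_of_conj hconj i j k l
    simp only [Matrix.add_apply, Matrix.smul_apply, Matrix.one_apply, Complex.ofReal_add]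
    by_cases hjl : j = l
    · subst hjl; ring
    · simp only [hjl, if_false]
      linear_combination this

end NCFunctional

/-! ### Probability measures and their moments -/

/-- The vector state of a self-adjoint operator at a unit vector is given by a compactly supported
probability measure. -/
theorem exists_spectralMeasure {E : Type*} [NormedAddCommGroup E] [InnerProductSpace ℂ E]
    [CompleteSpace E] {J : E →L[ℂ] E} (hJ : IsSelfAdjoint J) {e : E} (he : ‖e‖ = 1) :
    ∃ (μ : Measure ℝ) (K : ℝ), IsProbabilityMeasure μ ∧ (∀ᵐ x ∂μ, |x| ≤ K) ∧
      ∀ p : Polynomial ℝ, ∫ x, p.eval x ∂μ = (inner ℂ e (Polynomial.aeval J p e)).re := by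
  let L : C(spectrum ℝ J, ℝ) →ₗ[ℝ] ℝ :=
    { toFun := fun f => (inner ℂ e (cfcHom hJ f e)).re
      map_add' := fun f g => by
        rw [map_add, add_apply, inner_add_right, Complex.add_re]
      map_smul' := fun c f => by
        rw [map_smul, smul_apply, inner_smul_right_eq_smul]
        simp }
  have hL : ∀ f, 0 ≤ f → 0 ≤ L f := by
    intro f hf
    have h1 : 0 ≤ cfcHom hJ f := (cfcHom_nonneg_iff hJ).2 hf
    exact ((ContinuousLinearMap.nonneg_iff_isPositive _).1 h1).re_inner_nonneg_right e
  -- `f ↦ ⟨e, f(J) e⟩` is a positive functional on the compact spectrum; the Riesz–Markov theorem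
  -- provides the measure.
  let Λ : CompactlySupportedContinuousMap (spectrum ℝ J) ℝ →ₚ[ℝ] ℝ :=
    PositiveLinearMap.mk₀
      { toFun := fun f => L f.toContinuousMap
        map_add' := fun f g => map_add L f.toContinuousMap g.toContinuousMap
        map_smul' := fun c f => map_smul L c f.toContinuousMap }
      (fun f hf => hL f.toContinuousMap hf)
  let m : Measure (spectrum ℝ J) := RealRMK.rieszMeasure Λ
  have hm : ∀ f : C(spectrum ℝ J, ℝ), ∫ x, f x ∂m = L f := fun f =>
    RealRMK.integral_rieszMeasure Λ (CompactlySupportedContinuousMap.continuousMapEquiv f)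
  have hpoly : ∀ p : Polynomial ℝ, ∫ x, p.eval (x : ℝ) ∂m =
      (inner ℂ e (Polynomial.aeval J p e)).re := by
    intro p
    have h1 := hm ⟨_, p.continuous.continuousOn.domRestrict (s := spectrum ℝ J)⟩
    rw [← cfc_polynomial p J hJ, cfc_apply _ _ hJ p.continuous.continuousOn]
    exact h1
  refine ⟨m.map Subtype.val, ‖J‖ * ‖(1 : E →L[ℂ] E)‖, ⟨?_⟩, ?_, fun p => ?_⟩
  · rw [Measure.map_apply measurable_subtype_coe MeasurableSet.univ, Set.preimage_univ]
    have h1 := hpoly 1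
    simp only [Polynomial.eval_one, map_one, one_apply_eq_self,
      inner_self_eq_norm_sq_to_K, he, integral_const, smul_eq_mul, mul_one] at h1
    rw [← ofReal_measureReal, h1]
    simp
  · rw [ae_map_iff measurable_subtype_coe.aemeasurable
      (measurableSet_le continuous_abs.measurable measurable_const)]
    exact Filter.Eventually.of_forall fun x => spectrum.norm_le_norm_mul_of_mem x.2
  · rw [integral_map measurable_subtype_coe.aemeasurable
      p.continuous.aestronglyMeasurable, hpoly]

theorem integrable_eval {μ : Measure ℝ} (hμ : ∀ n : ℕ, Integrable (fun x : ℝ => x ^ n) μ)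
    (p : Polynomial ℝ) : Integrable (fun x => p.eval x) μ := by
  induction p using Polynomial.induction_on' with
  | add p q hp hq => simp only [Polynomial.eval_add]; exact hp.add hq
  | monomial n a => simpa only [Polynomial.eval_monomial] using (hμ n).const_mul a

/-- Integration of polynomials. -/
noncomputable def polyIntegral (μ : Measure ℝ)
    (hμ : ∀ n : ℕ, Integrable (fun x : ℝ => x ^ n) μ) : Polynomial ℝ →ₗ[ℝ] ℝ where
  toFun p := ∫ x, p.eval x ∂μ
  map_add' p q := by
    simp only [Polynomial.eval_add]
    exact integral_add (integrable_eval hμ p) (integrable_eval hμ q)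
  map_smul' c p := by
    simp only [Polynomial.eval_smul, smul_eq_mul, RingHom.id_apply]
    exact integral_const_mul c _

/-- A probability measure with finite moments whose moments are those of a compactly supported
one is equal to it. -/
theorem eq_of_integral_pow_eq {μ ν : Measure ℝ} [IsProbabilityMeasure μ] [IsProbabilityMeasure ν]
    {K : ℝ} (hK : ∀ᵐ x ∂ν, |x| ≤ K) (hμ : ∀ n : ℕ, Integrable (fun x : ℝ => x ^ n) μ)
    (hν : ∀ n : ℕ, Integrable (fun x : ℝ => x ^ n) ν)
    (h : ∀ n : ℕ, ∫ x, x ^ n ∂μ = ∫ x, x ^ n ∂ν) : μ = ν := by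
  have hK0 : 0 ≤ K := by
    obtain ⟨x, hx⟩ := hK.exists
    exact (abs_nonneg x).trans hx
  -- Markov's inequality for the even moments, which are at most `K ^ (2 * n)`: letting `n → ∞`
  -- confines `μ` to `[-(K + 1), K + 1]`, where Weierstrass approximation finishes.
  have hbound : ∀ n : ℕ, μ.real {x | K + 1 ≤ |x|} ≤ (K ^ 2 / (K + 1) ^ 2) ^ n := by
    intro n
    have h1 : ∫ x, x ^ (2 * n) ∂ν ≤ K ^ (2 * n) := by
      calc ∫ x, x ^ (2 * n) ∂ν ≤ ∫ _, K ^ (2 * n) ∂ν := by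
            refine integral_mono_ae (hν _) (integrable_const _) ?_
            filter_upwards [hK] with x hx
            rw [← (even_two_mul n).pow_abs]
            exact pow_le_pow_left₀ (abs_nonneg x) hx _
        _ = K ^ (2 * n) := by simp
    have h2 := mul_meas_ge_le_integral_of_nonneg (μ := μ) (f := fun x : ℝ => x ^ (2 * n))
      (Filter.Eventually.of_forall fun x => (even_two_mul n).pow_nonneg x) (hμ _)
      ((K + 1) ^ (2 * n))
    have h3 : μ.real {x | K + 1 ≤ |x|} ≤ μ.real {x | (K + 1) ^ (2 * n) ≤ x ^ (2 * n)} := by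
      refine measureReal_mono fun x hx => ?_
      change (K + 1) ^ (2 * n) ≤ x ^ (2 * n)
      rw [← (even_two_mul n).pow_abs x]
      exact pow_le_pow_left₀ (by linarith) hx _
    have h4 : 0 < (K + 1) ^ (2 * n) := by positivity
    rw [div_pow, ← pow_mul, ← pow_mul, le_div_iff₀ h4, mul_comm]
    exact (mul_le_mul_of_nonneg_left h3 h4.le).trans (h2.trans ((h _).trans_le h1))
  have hzero : μ.real {x | K + 1 ≤ |x|} = 0 := by
    refine le_antisymm (ge_of_tendsto' (tendsto_pow_atTop_nhds_zero_of_lt_one ?_ ?_) hbound)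
      measureReal_nonneg
    · positivity
    · rw [div_lt_one (by positivity)]
      nlinarith
  have hKμ : ∀ᵐ x ∂μ, x ∈ Set.Icc (-(K + 1)) (K + 1) := by
    rw [measureReal_eq_zero_iff] at hzero
    have : ∀ᵐ x ∂μ, ¬ (K + 1 ≤ |x|) := measure_eq_zero_iff_ae_notMem.1 hzero
    filter_upwards [this] with x hx
    exact abs_le.1 (not_le.1 hx).le
  have hKν : ∀ᵐ x ∂ν, x ∈ Set.Icc (-(K + 1)) (K + 1) := by
    filter_upwards [hK] with x hx
    exact abs_le.1 (by linarith)
  have hpoly : ∀ p : Polynomial ℝ, ∫ x, p.eval x ∂μ = ∫ x, p.eval x ∂ν := by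
    intro p
    have : polyIntegral μ hμ = polyIntegral ν hν := by
      ext n
      simpa [polyIntegral] using h n
    exact LinearMap.congr_fun this p
  refine ext_of_forall_integral_eq_of_IsFiniteMeasure fun f => ?_
  refine eq_of_forall_dist_le fun ε hε => ?_
  obtain ⟨p, hp⟩ := exists_polynomial_near_of_continuousOn (-(K + 1)) (K + 1) f
    f.continuous.continuousOn (ε / 2) (half_pos hε)
  have key : ∀ (ρ : Measure ℝ) [IsProbabilityMeasure ρ],
      (∀ n : ℕ, Integrable (fun x : ℝ => x ^ n) ρ) →
      (∀ᵐ x ∂ρ, x ∈ Set.Icc (-(K + 1)) (K + 1)) →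
      |∫ x, p.eval x ∂ρ - ∫ x, f x ∂ρ| ≤ ε / 2 := by
    intro ρ _ hρ hKρ
    rw [← integral_sub (integrable_eval hρ p) (f.integrable ρ), ← Real.norm_eq_abs]
    refine (norm_integral_le_of_norm_le_const (C := ε / 2) ?_).trans (by simp)
    filter_upwards [hKρ] with x hx
    exact (hp x hx).le
  have h1 := abs_le.1 (key μ hμ hKμ)
  have h2 := abs_le.1 (key ν hν hKν)
  rw [hpoly] at h1
  rw [Real.dist_eq, abs_le]
  constructor <;> linarith

/-! ### Jacobi parameters -/

theorem X_mul_jacobiPoly (β γ : ℕ → ℝ) (n : ℕ) :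
    Polynomial.X * jacobiPoly β γ (n + 1) = jacobiPoly β γ (n + 2)
      + β (n + 1) • jacobiPoly β γ (n + 1) + γ (n + 1) • jacobiPoly β γ n := by
  rw [jacobiPoly, Polynomial.smul_eq_C_mul, Polynomial.smul_eq_C_mul]
  ring

/-- The polynomials given by the three-term recursion span all polynomials. -/
theorem linearMap_ext_jacobiPoly {V : Type*} [AddCommGroup V] [Module ℝ V] {β γ : ℕ → ℝ}
    {f g : Polynomial ℝ →ₗ[ℝ] V} (h : ∀ n, f (jacobiPoly β γ n) = g (jacobiPoly β γ n)) :
    f = g := by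
  -- Stated for all products `X ^ k * P_n` because the recursion trades one factor `X` for
  -- neighbouring indices; `n = 0` gives the monomials.
  have key : ∀ k n, f (Polynomial.X ^ k * jacobiPoly β γ n) =
      g (Polynomial.X ^ k * jacobiPoly β γ n) := by
    intro k
    induction k with
    | zero => intro n; simpa using h n
    | succ k ih =>
      intro n
      rw [pow_succ, mul_assoc]
      rcases n with _ | n
      · have h1 : Polynomial.X * jacobiPoly β γ 0 =
            jacobiPoly β γ 1 + β 0 • jacobiPoly β γ 0 := by
          simp [jacobiPoly, Polynomial.smul_eq_C_mul]
        rw [h1, mul_add, map_add, map_add, mul_smul_comm, map_smul, map_smul, ih, ih]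
      · simp only [X_mul_jacobiPoly, mul_add, mul_smul_comm, map_add, map_smul, ih]
  refine Polynomial.lhom_ext' fun n => LinearMap.ext_ring ?_
  have := key n 0
  simpa [jacobiPoly, Polynomial.X_pow_eq_monomial] using this

theorem HasJacobiParameters.integral_jacobiPoly {β γ : ℕ → ℝ} {μ : Measure ℝ}
    (h : HasJacobiParameters β γ μ) (n : ℕ) :
    ∫ x, (jacobiPoly β γ n).eval x ∂μ = if n = 0 then 1 else 0 := by
  have := h.isProb
  split_ifs with hn
  · subst hn
    simp [jacobiPoly]
  · simpa [jacobiPoly] using h.orthogonal 0 n (Ne.symm hn)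

/-- Orthogonality to `P_0 = 1` already fixes the integrals of all `P_n`, and these span. -/
theorem HasJacobiParameters.polyIntegral_eq {β γ : ℕ → ℝ} {μ ν : Measure ℝ}
    (hμ : HasJacobiParameters β γ μ) (hν : HasJacobiParameters β γ ν) :
    polyIntegral μ hμ.moments = polyIntegral ν hν.moments := by
  refine linearMap_ext_jacobiPoly (β := β) (γ := γ) fun n => ?_
  exact (hμ.integral_jacobiPoly n).trans (hν.integral_jacobiPoly n).symm

/-- A self-adjoint operator with a sequence of orthogonal vectors on which it acts by a
three-term recursion gives a measure with these Jacobi parameters. -/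
theorem exists_hasJacobiParameters {E : Type*} [NormedAddCommGroup E] [InnerProductSpace ℂ E]
    [CompleteSpace E] {J : E →L[ℂ] E} (hJ : IsSelfAdjoint J) {β γ : ℕ → ℝ} {f : ℕ → E}
    (hf0 : ‖f 0‖ = 1) (hf : ∀ m n, m ≠ n → inner ℂ (f m) (f n) = 0)
    (h0 : J (f 0) = f 1 + β 0 • f 0)
    (hsucc : ∀ n, J (f (n + 1)) = f (n + 2) + β (n + 1) • f (n + 1) + γ (n + 1) • f n) :
    ∃ (μ : Measure ℝ) (K : ℝ), HasJacobiParameters β γ μ ∧ ∀ᵐ x ∂μ, |x| ≤ K := by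
  obtain ⟨μ, K, hμ, hK, hint⟩ := exists_spectralMeasure hJ hf0
  -- `P_n(J) f_0 = f_n`, carried for two consecutive indices as the three-term recursion requires.
  -- Orthogonality of the `P_n` is then that of the `f_n`.
  have hP : ∀ n, Polynomial.aeval J (jacobiPoly β γ n) (f 0) = f n ∧
      Polynomial.aeval J (jacobiPoly β γ (n + 1)) (f 0) = f (n + 1) := by
    intro n
    induction n with
    | zero => simp [jacobiPoly, h0, Algebra.algebraMap_eq_smul_one]
    | succ n ih =>
      refine ⟨ih.2, ?_⟩
      rw [jacobiPoly]
      simp only [map_sub, map_mul, Polynomial.aeval_X, Polynomial.aeval_C,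
        Algebra.algebraMap_eq_smul_one, sub_mul, smul_mul_assoc, one_mul,
        sub_apply, mul_apply_eq_comp,
        smul_apply, ih.1, ih.2, hsucc]
      abel
  refine ⟨μ, K, ⟨hμ, fun n => ?_, fun m n hmn => ?_⟩, hK⟩
  · refine (integrable_const (K ^ n)).mono' (by fun_prop) ?_
    filter_upwards [hK] with x hx
    rw [norm_pow]
    exact pow_le_pow_left₀ (norm_nonneg x) hx n
  · have hsa : IsSelfAdjoint (Polynomial.aeval J (jacobiPoly β γ m)) := by
      rw [← cfc_polynomial _ J hJ]
      exact cfc_predicate _ J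
    have h1 := hint (jacobiPoly β γ m * jacobiPoly β γ n)
    simp only [Polynomial.eval_mul, map_mul, mul_apply_eq_comp] at h1
    rw [h1, (hP n).1, ← ContinuousLinearMap.adjoint_inner_left, hsa.adjoint_eq, (hP m).1,
      hf m n hmn, Complex.zero_re]

/-- The unilateral shift: an isometry together with an orthonormal sequence. -/
theorem exists_shift : ∃ (S : lp (fun _ : ℕ => ℂ) 2 →L[ℂ] lp (fun _ : ℕ => ℂ) 2)
    (e : ℕ → lp (fun _ : ℕ => ℂ) 2), Orthonormal ℂ e ∧ (∀ n, S (e n) = e (n + 1)) ∧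
      (∀ n, star S (e (n + 1)) = e n) ∧ star S (e 0) = 0 := by
  let e : ℕ → lp (fun _ : ℕ => ℂ) 2 := fun n => lp.single 2 n 1
  have he : Orthonormal ℂ e := by
    rw [orthonormal_iff_ite]
    intro m n
    rw [lp.inner_single_left]
    by_cases h : m = n
    · subst h; simp [e]
    · simp [e, h]
  -- `S` is the isometry attached to the shifted orthonormal family `e_1, e_2, …`.
  have hV := (he.comp _ Nat.succ_injective).orthogonalFamily
  have hS : ∀ n, hV.linearIsometry.toContinuousLinearMap (e n) = e (n + 1) := by
    intro n
    refine (hV.linearIsometry_apply_single (i := n) 1).trans ?_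
    simp
  have hcoord : ∀ m n, (star hV.linearIsometry.toContinuousLinearMap (e m)) n =
      inner ℂ (e (n + 1)) (e m) := by
    intro m n
    rw [← hS, ← ContinuousLinearMap.adjoint_inner_right, lp.inner_single_left]
    simp [ContinuousLinearMap.star_eq_adjoint]
  refine ⟨hV.linearIsometry.toContinuousLinearMap, e, he, hS, fun m => ?_, ?_⟩
  · ext n
    rw [hcoord, orthonormal_iff_ite.1 he]
    by_cases h : n = m
    · subst h; simp [e]
    · simp [e, h]
  · ext n
    rw [hcoord, orthonormal_iff_ite.1 he]
    simp

/-- The free Meixner distribution as the spectral measure of a modification of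
`s (S + S^*) + b`, with the shift `S`. -/
theorem exists_isFreeMeixner_of_shift {E : Type*} [NormedAddCommGroup E]
    [InnerProductSpace ℂ E] [CompleteSpace E] {S : E →L[ℂ] E} {e : ℕ → E} (he : Orthonormal ℂ e)
    (hS : ∀ n, S (e n) = e (n + 1)) (hS' : ∀ n, star S (e (n + 1)) = e n)
    (hS0 : star S (e 0) = 0) (b : ℝ) {c : ℝ} (hc : -1 ≤ c) :
    ∃ (μ : Measure ℝ) (K : ℝ), IsFreeMeixner b c μ ∧ ∀ᵐ x ∂μ, |x| ≤ K := by
  set s : ℝ := √(1 + c) with hs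
  have hss : s * s = 1 + c := Real.mul_self_sqrt (by linarith)
  -- On the `e_n`, `Q` is the projection onto `e_0`. The `(1 - s)` term corrects the first
  -- off-diagonal entry of `J` from `s` to `1`, and `S * star S` puts `b` on the diagonal except at
  -- `e_0`.
  let Q := 1 - S * star S
  let J := s • (S + star S) + (1 - s) • (S * Q + Q * star S) + b • (S * star S)
  have hJ : IsSelfAdjoint J := by
    simp only [J, Q, IsSelfAdjoint, star_add, star_sub, star_smul, star_mul, star_star, star_one,
      star_trivial]
    rw [add_comm (star S) S, add_comm ((1 - S * star S) * star S)]
  have hQ0 : Q (e 0) = e 0 := by simp [Q, hS0]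
  have hQ : ∀ n, Q (e (n + 1)) = 0 := fun n => by simp [Q, hS, hS']
  have hJe : ∀ v, J v = s • (S v + star S v) + (1 - s) • (S (Q v) + Q (star S v))
      + b • S (star S v) := fun v => rfl
  -- The rescaling that makes the recursion monic. Truncated subtraction gives `κ 0 = κ 1 = 1`, and
  -- for `s = 0` the vectors vanish from index two on.
  let κ : ℕ → ℝ := fun n => s ^ (n - 1)
  have hκ : ∀ n, κ (n + 1) = s ^ n := fun n => rfl
  refine exists_hasJacobiParameters hJ (f := fun n => κ n • e n) ?_ (fun m n hmn => ?_) ?_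
    (fun n => ?_)
  · simp [κ, he.1 0]
  · rw [inner_smul_left_eq_smul, inner_smul_right_eq_smul, he.2 hmn, smul_zero, smul_zero]
  · simp only [κ, pow_zero, one_smul, hJe, hQ0, hS, hS0, map_zero, if_true,
      Nat.zero_sub, Nat.sub_self, zero_add, add_zero, smul_zero]
    module
  · rcases n with _ | n
    · simp only [κ, zero_add, pow_zero, one_smul, hJe, hQ 0, hS, hS' 0, hQ0, map_zero,
        Nat.zero_sub, Nat.sub_self, one_ne_zero, if_false, if_true, pow_one,
        show 2 - 1 = 1 from rfl]
      module
    · have h1 : n + 1 + 1 ≠ 0 := by omega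
      have h2 : n + 1 + 1 ≠ 1 := by omega
      simp only [hκ, if_neg h1, if_neg h2, ContinuousLinearMap.map_smul_of_tower J, hJe, hQ, hS,
        hS', map_zero, ← hss]
      module

theorem existsUnique_isFreeMeixner (b : ℝ) {c : ℝ} (hc : -1 ≤ c) :
    ∃! μ : Measure ℝ, IsFreeMeixner b c μ := by
  obtain ⟨S, e, he, hS, hS', hS0⟩ := exists_shift
  obtain ⟨ν, K, hν, hK⟩ := exists_isFreeMeixner_of_shift he hS hS' hS0 b hc
  refine ⟨ν, hν, fun μ hμ => ?_⟩
  have := hμ.isProb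
  have := hν.isProb
  refine eq_of_integral_pow_eq hK hμ.moments hν.moments fun n => ?_
  have h := LinearMap.congr_fun (HasJacobiParameters.polyIntegral_eq hμ hν) (Polynomial.X ^ n)
  simpa [polyIntegral] using h

/-- `P_2 = x² - 1` vanishes on the two atoms, and with `γ_n = 0` for `n ≥ 2` it divides all later
`P_n`; only `P_0` and `P_1` remain to be checked. -/
theorem isFreeMeixner_bernoulliSym : IsFreeMeixner 0 (-1) bernoulliSym := by
  have hint : ∀ f : ℝ → ℝ, Integrable f bernoulliSym := fun f =>
    ((integrable_dirac (by simp)).smul_measure (by simp)).add_measure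
      ((integrable_dirac (by simp)).smul_measure (by simp))
  have hval : ∀ f : ℝ → ℝ, ∫ x, f x ∂bernoulliSym = (f (-1) + f 1) / 2 := by
    intro f
    have h1 := (integrable_add_measure.1 (hint f))
    rw [bernoulliSym, integral_add_measure h1.1 h1.2, integral_smul_measure,
      integral_smul_measure, integral_dirac, integral_dirac]
    simp
    ring
  have hzero : ∀ n (x : ℝ), x ^ 2 = 1 → (jacobiPoly (fun n => if n = 0 then 0 else 0)
      (fun n => if n = 1 then 1 else 1 + -1) (n + 2)).eval x = 0 := by
    intro n x hx
    induction n with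
    | zero => simp [jacobiPoly]; linarith
    | succ n ih => rw [jacobiPoly, Polynomial.eval_sub, Polynomial.eval_mul, ih]; simp
  refine ⟨⟨by simp [bernoulliSym, ENNReal.inv_two_add_inv_two]⟩, fun n => hint _,
    fun m n hmn => ?_⟩
  rw [hval]
  have key : ∀ n, (jacobiPoly (fun n => if n = 0 then 0 else 0)
      (fun n => if n = 1 then 1 else 1 + -1) (n + 2)).eval (1 : ℝ) = 0 ∧
      (jacobiPoly (fun n => if n = 0 then 0 else 0)
      (fun n => if n = 1 then 1 else 1 + -1) (n + 2)).eval (-1 : ℝ) = 0 :=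
    fun n => ⟨hzero n 1 (by norm_num), hzero n (-1) (by norm_num)⟩
  rcases m with _ | _ | m
  · rcases n with _ | _ | n
    · exact absurd rfl hmn
    · simp [jacobiPoly]
    · rw [(key n).1, (key n).2]; simp
  · rcases n with _ | _ | n
    · simp [jacobiPoly]
    · exact absurd rfl hmn
    · rw [(key n).1, (key n).2]; simp
  · rw [(key m).1, (key m).2]; simp

namespace NCFunctional

open NCSeries

/-! ### Free Meixner distributions as free Meixner states in one variable -/

/-- The matrices `T_i` in one variable. -/
noncomputable def scalarT (b : ℝ) : Fin 1 → Matrix (Fin 1) (Fin 1) ℂ := fun _ => (b : ℂ) • 1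

/-- The matrix `C` in one variable. -/
def scalarC (c : ℝ) : Matrix (Fin 1) (Fin 1) ℝ := Matrix.of fun _ _ => c

/-- The orthogonal polynomials produce the basis vectors of the Fock space. -/
theorem aeval_fockX_jacobiPoly (b c : ℝ) (n : ℕ) :
    Polynomial.aeval (fockX (scalarT b) (scalarC c) 0)
      ((jacobiPoly (fun n => if n = 0 then 0 else b) (fun n => if n = 1 then 1 else 1 + c) n).map
        Complex.ofRealHom) (Finsupp.single [] 1) = Finsupp.single (List.replicate n 0) 1 := by
  have h0 : fockX (scalarT b) (scalarC c) 0 (Finsupp.single [] 1) =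
      Finsupp.single (List.replicate 1 0) 1 := by
    rw [fockX_single]; rfl
  have hsucc : ∀ n, fockX (scalarT b) (scalarC c) 0 (Finsupp.single (List.replicate (n + 1) 0) 1) =
      Finsupp.single (List.replicate (n + 2) 0) 1
        + (b : ℂ) • Finsupp.single (List.replicate (n + 1) 0) 1
        + ((if n = 0 then 1 else 1 + c : ℝ) : ℂ) • Finsupp.single (List.replicate n 0) 1 := by
    intro n
    rw [fockX_single, List.replicate_succ, fockAct]
    have hT : scalarT b 0 0 0 = b := by simp [scalarT]
    rcases n with _ | n <;> simp [hT, scalarC, stepWeight, List.replicate_succ]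
  induction n using Nat.twoStepInduction with
  | zero => simp [jacobiPoly]
  | one => simp [jacobiPoly, h0]
  | more n ih1 ih2 =>
    rw [jacobiPoly]
    simp only [Polynomial.map_sub, Polynomial.map_mul, Polynomial.map_X, Polynomial.map_C, map_sub,
      map_mul, Polynomial.aeval_X, Polynomial.aeval_C, LinearMap.sub_apply, Module.End.mul_apply,
      Module.algebraMap_end_apply, ih1, ih2, hsucc, Complex.ofRealHom_eq_coe,
      Nat.add_eq_right, Nat.succ_ne_zero, if_false]
    abel

theorem monomial_eq_pow (u : List (Fin 1)) :
    monomial u = (FreeAlgebra.ι ℂ (0 : Fin 1)) ^ u.length := by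
  have : u = List.replicate u.length 0 :=
    List.eq_replicate_iff.2 ⟨rfl, fun x _ => Subsingleton.elim x 0⟩
  rw [monomial, this]
  simp

/-- The restriction to real polynomials of a functional in one variable. -/
noncomputable def onRealPolynomials (φ : NCFunctional 1) : Polynomial ℝ →ₗ[ℝ] ℂ where
  toFun p := φ (Polynomial.aeval (FreeAlgebra.ι ℂ 0) (p.map Complex.ofRealHom))
  map_add' p q := by simp only [Polynomial.map_add, map_add]
  map_smul' a p := by
    rw [Polynomial.smul_eq_C_mul, Polynomial.map_mul, Polynomial.map_C, ← Polynomial.smul_eq_C_mul,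
      map_smul, map_smul]
    rfl

/-- The vacuum expectation of `P_n(X)` is `1` for `n = 0` and `0` otherwise, because `P_n(X)` maps
the vacuum to the `n`-th basis vector. These are also the integrals of `P_n` against `μ`, and the
`P_n` span. -/
theorem isBooleanMeixner_ofMeasure {b c : ℝ} {μ : Measure ℝ} (hμ : IsFreeMeixner b c μ) :
    IsBooleanMeixner (scalarT b) (scalarC c) (ofMeasure μ).eta := by
  obtain ⟨h, hh, -⟩ := existsUnique_isBooleanMeixner (scalarT b) (scalarC c)
  rw [← eta_ofEta hh.nil] at hh
  suffices ofMeasure μ = ofEta h by rwa [this]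
  have key : Complex.ofRealCLM.toLinearMap ∘ₗ polyIntegral μ hμ.moments =
      onRealPolynomials (ofEta h) := by
    refine linearMap_ext_jacobiPoly (β := fun n => if n = 0 then 0 else b)
      (γ := fun n => if n = 1 then 1 else 1 + c) fun n => ?_
    have h1 := HasJacobiParameters.integral_jacobiPoly hμ n
    simp only [onRealPolynomials, polyIntegral, LinearMap.comp_apply, LinearMap.coe_mk, AddHom.coe_mk, h1]
    rw [apply_eq_fockRep _ _ (ofEta_one h) hh, ← Polynomial.aeval_algHom_apply, fockRep,
      FreeAlgebra.lift_ι_apply, aeval_fockX_jacobiPoly]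
    rcases n with _ | n <;> simp [List.replicate_succ]
  refine ext_monomial fun u => ?_
  have h2 := LinearMap.congr_fun key (Polynomial.X ^ u.length)
  simp only [onRealPolynomials, polyIntegral, LinearMap.comp_apply, LinearMap.coe_mk, AddHom.coe_mk,
    Polynomial.eval_pow, Polynomial.eval_X, Polynomial.map_pow, Polynomial.map_X, map_pow,
    Polynomial.aeval_X, ← monomial_eq_pow] at h2
  rw [← h2]
  refine (ofMoments_monomial _ u).trans ?_
  have := hμ.isProb
  split_ifs with hu
  · simp [hu]
  · simp

theorem eq_ofMeasure {b c : ℝ} {μ : Measure ℝ} (hμ : IsFreeMeixner b c μ) {φ : NCFunctional 1}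
    (hφ : φ 1 = 1) (h : IsBooleanMeixner (scalarT b) (scalarC c) φ.eta) : φ = ofMeasure μ :=
  ext_eta hφ (ofMoments_one _) ((existsUnique_isBooleanMeixner _ _).unique h
    (isBooleanMeixner_ofMeasure hμ))

theorem Phi_ofMeasure {b c α t : ℝ} {μ ν : Measure ℝ} (hμ : IsFreeMeixner b c μ)
    (hν : IsFreeMeixner (b + α) (c + t) ν) :
    Phi (ofMeasure μ) (((ofMeasure μ).boxpow (1 + t)).boxplus (delta fun _ => α)) =
      ofMeasure ν := by
  have hB := isBooleanMeixner_ofMeasure hμ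
  have h0 : ∀ i, ofMeasure μ (FreeAlgebra.ι ℂ i) = 0 := fun i => by
    rw [← eta_singleton, hB.singleton]
  refine eq_ofMeasure hν (ofEta_one _) ?_
  have h1 := isBooleanMeixner_eta_Phi h0 hB (fun _ => α) t
  have e1 : (fun i => ((fun _ => α) i : ℂ) • (1 : Matrix (Fin 1) (Fin 1) ℂ) + scalarT b i) =
      scalarT (b + α) := by
    funext i
    rw [scalarT, scalarT, ← add_smul, Complex.ofReal_add, add_comm]
  have e2 : (Matrix.of fun i j => t + scalarC c i j) = scalarC (c + t) := by
    ext i j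
    exact add_comm t c
  rwa [e1, e2] at h1

theorem BT_ofMeasure {b c α t : ℝ} (ht : t ≠ -1) {μ ν : Measure ℝ} (hμ : IsFreeMeixner b c μ)
    (hν : IsFreeMeixner (b + α) (c + t) ν) :
    BT (fun _ => α) t (ofMeasure μ) = ofMeasure ν := by
  rw [BT_eq_Phi _ _ ht, Phi_ofMeasure hμ hν]

end NCFunctional

open scoped Kronecker in
theorem mainTheorem6 :
    -- the free Meixner distributions `μ_{b, c}`, `b ∈ ℝ`, `1 + c ≥ 0`, are well defined
    (∀ b c : ℝ, -1 ≤ c → ∃! μ : Measure ℝ, IsFreeMeixner b c μ) ∧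
    -- the free Meixner states `φ_{{T_i}, C}` are well defined
    (∀ (d : ℕ) (T : Fin d → Matrix (Fin d) (Fin d) ℂ) (C : Matrix (Fin d) (Fin d) ℝ),
      (∀ i, (T i).IsHermitian) → (∀ i j, -1 ≤ C i j) →
      (∀ i, Commute (T i ⊗ₖ (1 : Matrix (Fin d) (Fin d) ℂ))
        (Matrix.diagonal fun p : Fin d × Fin d => (C p.1 p.2 : ℂ))) →
      ∃! φ : NCFunctional d, NCFunctional.IsFreeMeixnerState T C φ) ∧
    -- `B_{α, t}[μ_{b, c}] = μ_{b + α, c + t}`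
    (∀ b c α t : ℝ, -1 ≤ c → -1 ≤ c + t → t ≠ -1 →
      ∀ μ : Measure ℝ, IsFreeMeixner b c μ →
      ∃ ν : Measure ℝ, IsFreeMeixner (b + α) (c + t) ν ∧
        NCFunctional.BT (fun _ => α) t (NCFunctional.ofMeasure μ) = NCFunctional.ofMeasure ν) ∧
    -- `B_{a, t}[φ_{{T_i}, C}] = φ_{{a_i I + T_i}, t I + C}`
    (∀ (d : ℕ) (T : Fin d → Matrix (Fin d) (Fin d) ℂ) (C : Matrix (Fin d) (Fin d) ℝ)
      (a : Fin d → ℝ) (t : ℝ), (∀ i j, -1 ≤ t + C i j) → t ≠ -1 →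
      ∀ φ : NCFunctional d, NCFunctional.IsFreeMeixnerState T C φ →
      NCFunctional.IsFreeMeixnerState
        (fun i => (a i : ℂ) • (1 : Matrix (Fin d) (Fin d) ℂ) + T i)
        (Matrix.of fun i j => t + C i j) (NCFunctional.BT a t φ)) ∧
    -- every `μ_{b, c}` comes from the Bernoulli distribution
    (IsFreeMeixner 0 (-1) bernoulliSym ∧
      ∀ b c : ℝ, -1 ≤ c → ∀ μ : Measure ℝ, IsFreeMeixner b c μ →
      ∃ α t : ℝ, 0 ≤ t ∧ NCFunctional.BT (fun _ => α) t (NCFunctional.ofMeasure bernoulliSym) =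
        NCFunctional.ofMeasure μ) ∧
    -- `Φ[μ_{b, c}, μ_{b, c}^{⊞ (1 + t)} ⊞ δ_α] = B_{α, t}[μ_{b, c}] = μ_{b + α, c + t}`
    (∀ b c α t : ℝ, -1 ≤ c → -1 ≤ c + t →
      ∀ μ : Measure ℝ, IsFreeMeixner b c μ →
      ∃ ν : Measure ℝ, IsFreeMeixner (b + α) (c + t) ν ∧
        NCFunctional.Phi (NCFunctional.ofMeasure μ)
          (((NCFunctional.ofMeasure μ).boxpow (1 + t)).boxplus
            (NCFunctional.delta fun _ => α)) = NCFunctional.ofMeasure ν ∧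
        (t ≠ -1 → NCFunctional.BT (fun _ => α) t (NCFunctional.ofMeasure μ) =
          NCFunctional.ofMeasure ν)) := by
  refine ⟨fun b c hc => existsUnique_isFreeMeixner b hc, fun d T C hT hC hTC => ?_,
    fun b c α t _ hct ht μ hμ => ?_, fun d T C a t hC ht φ hφ => ?_,
    ⟨isFreeMeixner_bernoulliSym, fun b c hc μ hμ => ?_⟩, fun b c α t _ hct μ hμ => ?_⟩
  · refine NCFunctional.existsUnique_isFreeMeixnerState hT (fun i j k l => ?_) hC
    -- The entry at `(j, k)`, `(l, k)` of the commutation relation; equal second indices make the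
    -- identity factor `1`.
    have h := congrFun (congrFun (hTC i).eq (j, k)) (l, k)
    simpa [Matrix.mul_diagonal, Matrix.diagonal_mul] using h
  · obtain ⟨ν, hν, -⟩ := existsUnique_isFreeMeixner (b + α) hct
    exact ⟨ν, hν, NCFunctional.BT_ofMeasure ht hμ hν⟩
  · rw [NCFunctional.BT_eq_Phi _ _ ht]
    exact NCFunctional.isFreeMeixnerState_Phi hC hφ
  -- From `μ_{0,-1}` the shift must be `(b, c + 1)`, and `c ≥ -1` gives `t ≥ 0`, in particular `t ≠
  -- -1`.
  · refine ⟨b, c + 1, by linarith,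
      NCFunctional.BT_ofMeasure (by linarith) isFreeMeixner_bernoulliSym ?_⟩
    rwa [zero_add, neg_add_cancel_comm_assoc]
  · obtain ⟨ν, hν, -⟩ := existsUnique_isFreeMeixner (b + α) hct
    exact ⟨ν, hν, NCFunctional.Phi_ofMeasure hμ hν,
      fun ht => NCFunctional.BT_ofMeasure ht hμ hν⟩
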